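/- Let $(V,H,V^*)$ be a Gelfand triple: $V$ is a separable reflexive real Banach space with norm $\|\cdot\|_V$, $H$ is a separable real Hilbert space, $V\subset H$ continuously and densely, and $H\cong H^*\subset V^*$ via $h\mapsto\langle h,\cdot\rangle_H$. Let $\langle\cdot,\cdot\rangle$ denote the pairing between $V^*$ and $V$. Let $T>0$, $u_0\in H$, $B\in L^2([0,T];V^*)$, and let $A:V\to V^*$ be a (not necessarily linear) map such that - (H1') (coercivity) there is $\alpha>0$ with $2\langle A(u),u\rangle+\alpha\|u\|_V^2\le 0$ for all $u\in V$; - (H2') (monotonicity) $\langle A(u)-A(w),u-w\rangle\le 0$ for all $u,w\in V$; - (H3) (linear growth) there is $c>0$ with $\|A(u)\|_{V^*}\le c(1+\|u\|_V)$ for all $u\in V$; - (H4) (hemicontinuity) for all $u,v,w\in V$ the map $\mathbb{R}\ni\theta\mapsto\langle A(u+\theta w),v\rangle$ is continuous. Then there exists a unique weak solution $u\in L^2([0,T];V)\cap C([0,T];H)$ of $$\partial_t u-A(u)=B,\qquad u|_{t=0}=u_0 .$$ Here $u\in L^2([0,T];V)$ is a weak solution of $\partial_t u-A(u)=B$ if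 there is $\frac{d}{dt}u\in L^2([0,T];V^*)$ with $\int_0^T\varphi'(t)\,u_t\,dt=-\int_0^T\varphi(t)\,\tfrac{d}{dt}u_t\,dt$ in $V^*$ for all $\varphi\in C_c^\infty((0,T);\mathbb{R})$, and, for almost every $t\in[0,T]$, $\langle\frac{d}{dt}u_t,v\rangle=\langle A(u_t),v\rangle+\langle B_t,v\rangle$ for all $v\in V$. That $u\in C([0,T];H)$ means that $u$ agrees almost everywhere on $[0,T]$ with a continuous function $[0,T]\to H$; the initial condition is imposed on this continuous function. -/

import Mathlib

open MeasureTheory Set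
open scoped ContDiff

noncomputable section

/-- The space `L²([0,T]; E)`. -/
abbrev L2Time (T : ℝ) (E : Type*) [NormedAddCommGroup E] : Type _ :=
  Lp E 2 ((volume : Measure ℝ).restrict (Icc 0 T))

/-- `v` is the weak derivative in time on `(0,T)` of the `E`-valued function `u`:
both are Bochner integrable on `[0,T]` and `∫₀ᵀ φ'(t) u(t) dt = - ∫₀ᵀ φ(t) v(t) dt` in `E`
for all `φ ∈ C_c^∞((0,T); ℝ)`. -/
def HasWeakTimeDeriv {E : Type*} [NormedAddCommGroup E] [NormedSpace ℝ E]
    (T : ℝ) (u v : ℝ → E) : Prop :=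
  IntegrableOn u (Icc 0 T) ∧ IntegrableOn v (Icc 0 T) ∧
    ∀ φ : ℝ → ℝ, ContDiff ℝ ∞ φ → HasCompactSupport φ → tsupport φ ⊆ Ioo 0 T →
      ∫ t in Icc 0 T, deriv φ t • u t = -∫ t in Icc 0 T, φ t • v t

section Gelfand

variable {V H : Type*} [NormedAddCommGroup V] [NormedSpace ℝ V]
  [NormedAddCommGroup H] [InnerProductSpace ℝ H]

/-- `(V, H, V*)` is a Gelfand triple, the inclusion `V ⊂ H` being given by `ι`: the spaces are
separable and complete, `V` is reflexive, and `ι` is a continuous injection with dense range (so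
that `H ≅ H* ⊂ V*`). -/
structure IsGelfandTriple (ι : V →L[ℝ] H) : Prop where
  completeSpace_V : CompleteSpace V
  completeSpace_H : CompleteSpace H
  separableSpace_V : TopologicalSpace.SeparableSpace V
  separableSpace_H : TopologicalSpace.SeparableSpace H
  reflexive_V : Function.Surjective (NormedSpace.inclusionInDoubleDual ℝ V)
  injective : Function.Injective ι
  denseRange : DenseRange ι

/-- The inclusion `H ≅ H* ⊂ V*`, sending `h` to the functional `v ↦ ⟨h, v⟩_H`. -/
def toVDual (ι : V →L[ℝ] H) (h : H) : StrongDual ℝ V := (innerSL ℝ h).comp ι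

/-- Coercivity: `2 ⟨A(u), u⟩ + α ‖u‖_V² ≤ 0` for some `α > 0`. -/
def IsCoerciveOp (A : V → StrongDual ℝ V) : Prop :=
  ∃ α : ℝ, 0 < α ∧ ∀ u : V, 2 * A u u + α * ‖u‖ ^ 2 ≤ 0

/-- Monotonicity (dissipative sign convention): `⟨A(u) - A(w), u - w⟩ ≤ 0`. -/
def IsMonotoneOp (A : V → StrongDual ℝ V) : Prop :=
  ∀ u w : V, (A u - A w) (u - w) ≤ 0

/-- Linear growth: `‖A(u)‖_{V*} ≤ c (1 + ‖u‖_V)` for some `c > 0`. -/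
def HasLinearGrowth (A : V → StrongDual ℝ V) : Prop :=
  ∃ c : ℝ, 0 < c ∧ ∀ u : V, ‖A u‖ ≤ c * (1 + ‖u‖)

/-- Hemicontinuity: `θ ↦ ⟨A(u + θ w), v⟩` is continuous on `ℝ` for all `u, v, w ∈ V`. -/
def IsHemicontinuous (A : V → StrongDual ℝ V) : Prop :=
  ∀ u v w : V, Continuous fun θ : ℝ => A (u + θ • w) v

/-- `u ∈ L²([0,T]; V)` is a weak solution of `∂ₜu - A(u) = B`: its weak time derivative, computed
in `V*`, exists and lies in `L²([0,T]; V*)`, and `⟨du/dt, v⟩ = ⟨A(u(t)), v⟩ + ⟨B(t), v⟩` for almost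
every `t` and every `v ∈ V`. -/
def IsWeakSolution {T : ℝ} (ι : V →L[ℝ] H) (A : V → StrongDual ℝ V)
    (B : L2Time T (StrongDual ℝ V)) (u : L2Time T V) : Prop :=
  ∃ u' : L2Time T (StrongDual ℝ V),
    HasWeakTimeDeriv T (fun t => toVDual ι (ι (u t))) u' ∧
      ∀ᵐ t ∂(volume : Measure ℝ).restrict (Icc 0 T), ∀ v : V, u' t v = A (u t) v + B t v

/-- The continuous function `U : [0,T] → H` is a version of `u ∈ L²([0,T]; V)`. -/
def IsContinuousVersion {T : ℝ} (ι : V →L[ℝ] H) (u : L2Time T V) (U : C(Icc (0 : ℝ) T, H)) :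
    Prop :=
  ∀ᵐ t ∂(volume : Measure ℝ), ∀ ht : t ∈ Icc 0 T, U ⟨t, ht⟩ = ι (u t)

end Gelfand

end

open scoped ENNReal InnerProductSpace Topology
open Filter

noncomputable section

/-- A normed space with separable dual is separable. -/
theorem separableSpace_of_separableSpace_dual (E : Type*) [NormedAddCommGroup E] [NormedSpace ℝ E]
    [TopologicalSpace.SeparableSpace (StrongDual ℝ E)] : TopologicalSpace.SeparableSpace E := by
  let f := TopologicalSpace.denseSeq (StrongDual ℝ E)
  have hx : ∀ n, ∃ x : E, ‖x‖ ≤ 1 ∧ ‖f n‖ / 2 ≤ ‖f n x‖ := by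
    intro n
    by_contra! h
    rcases eq_or_lt_of_le (norm_nonneg (f n)) with h0 | h0
    · have := h 0 (by simp)
      rw [← h0] at this
      simp at this
    · have : ‖f n‖ ≤ ‖f n‖ / 2 :=
        ContinuousLinearMap.opNorm_le_of_unit_norm (by positivity)
          fun x hx => (h x hx.le).le
      linarith
  choose x hx1 hx2 using hx
  let S : Submodule ℝ E := (Submodule.span ℝ (range x)).topologicalClosure
  have hS : S = ⊤ := by
    by_contra hne
    obtain ⟨z, hz⟩ : ∃ z, z ∉ S := by
      by_contra! h
      exact hne (Submodule.eq_top_iff'.2 h)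
    obtain ⟨g, u, hg1, hg2⟩ := geometric_hahn_banach_closed_point (s := (S : Set E))
      S.convex (Submodule.isClosed_topologicalClosure _) hz
    have hg0 : ∀ y ∈ S, g y = 0 := by
      intro y hy
      by_contra hne
      have h1 := hg1 ((u / g y) • y) (S.smul_mem _ hy)
      rw [map_smul, smul_eq_mul, div_mul_cancel₀ _ hne] at h1
      exact lt_irrefl _ h1
    have hgne : g ≠ 0 := by
      rintro rfl
      have := hg1 0 S.zero_mem
      simp at this hg2
      linarith
    have hgpos : 0 < ‖g‖ := norm_pos_iff.2 hgne
    obtain ⟨n, hn⟩ := (TopologicalSpace.denseRange_denseSeq (StrongDual ℝ E)).exists_dist_lt g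
      (ε := ‖g‖ / 4) (by positivity)
    rw [dist_eq_norm] at hn
    have h1 : ‖f n (x n)‖ ≤ ‖g - f n‖ := by
      have h2 : g (x n) = 0 :=
        hg0 _ (Submodule.le_topologicalClosure _ (Submodule.subset_span ⟨n, rfl⟩))
      have h3 : ‖(g - f n) (x n)‖ ≤ ‖g - f n‖ * ‖x n‖ := (g - f n).le_opNorm _
      rw [sub_apply, h2, zero_sub, norm_neg] at h3
      exact h3.trans (mul_le_of_le_one_right (norm_nonneg _) (hx1 n))
    have h4 : ‖g‖ ≤ ‖g - f n‖ + ‖f n‖ := by simpa using norm_add_le (g - f n) (f n)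
    have h5 := hx2 n
    change ‖g - f n‖ < _ at hn
    linarith
  have h1 : TopologicalSpace.IsSeparable (S : Set E) := by
    rw [Submodule.topologicalClosure_coe]
    exact ((countable_range x).isSeparable.span (R := ℝ)).closure
  rw [hS] at h1
  exact TopologicalSpace.isSeparable_univ_iff.1 (by simpa using h1)

instance separableSpace_l2 : TopologicalSpace.SeparableSpace (lp (fun _ : ℕ => ℝ) 2) := by
  let e : ℕ → lp (fun _ : ℕ => ℝ) 2 := fun i => lp.single 2 i (1 : ℝ)
  have h1 : TopologicalSpace.IsSeparable
      (closure (Submodule.span ℝ (range e) : Set (lp (fun _ : ℕ => ℝ) 2))) :=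
    ((countable_range e).isSeparable.span (R := ℝ)).closure
  refine TopologicalSpace.isSeparable_univ_iff.1 (h1.mono fun f _ => ?_)
  have h2 := lp.hasSum_single (p := 2) (by simp) f
  refine mem_closure_of_tendsto h2 (Filter.Eventually.of_forall fun s => ?_)
  refine Submodule.sum_mem _ fun i _ => ?_
  have : lp.single 2 i (f i) = (f i) • e i := by
    rw [← lp.single_smul]; simp
  rw [this]
  exact Submodule.smul_mem _ _ (Submodule.subset_span ⟨i, rfl⟩)

/-- Every separable Banach space is the closure of the range of a bounded operator on `ℓ²`. -/
theorem exists_l2_denseRange (E : Type*) [NormedAddCommGroup E] [NormedSpace ℝ E] [CompleteSpace E]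
    [TopologicalSpace.SeparableSpace E] :
    ∃ j : lp (fun _ : ℕ => ℝ) 2 →L[ℝ] E, DenseRange j := by
  let d := TopologicalSpace.denseSeq E
  let c : ℕ → ℝ := fun i => (1 / 2) ^ i / (1 + ‖d i‖)
  have hc : ∀ i, 0 < c i := fun i => by positivity
  let φ : ℕ → lp (fun _ : ℕ => ℝ) 2 →L[ℝ] ℝ := fun i => lp.evalCLM ℝ (fun _ : ℕ => ℝ) 2 i
  have hφe : ∀ i x, φ i x = x i := fun _ _ => rfl
  have hφ : ∀ i, ‖φ i‖ ≤ 1 := fun i =>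
    ContinuousLinearMap.opNorm_le_bound _ zero_le_one fun x => by
      simpa [hφe] using lp.norm_apply_le_norm (by simp) x i
  have hs : Summable fun i => (φ i).smulRight (c i • d i) := by
    refine Summable.of_norm_bounded (summable_geometric_of_lt_one (r := (1 / 2 : ℝ))
      (by norm_num) (by norm_num)) fun i => ?_
    rw [ContinuousLinearMap.norm_smulRight_apply, norm_smul, Real.norm_of_nonneg (hc i).le]
    have h1 : c i * ‖d i‖ ≤ (1 / 2) ^ i := by
      simp only [c]
      rw [div_mul_eq_mul_div, div_le_iff₀ (by positivity)]
      gcongr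
      linarith
    calc ‖φ i‖ * (c i * ‖d i‖) ≤ 1 * (1 / 2) ^ i := by gcongr; exact hφ i
      _ = _ := one_mul _
  refine ⟨∑' i, (φ i).smulRight (c i • d i), ?_⟩
  refine (TopologicalSpace.denseRange_denseSeq E).mono ?_
  rintro _ ⟨i, rfl⟩
  refine ⟨(c i)⁻¹ • lp.single 2 i (1 : ℝ), ?_⟩
  have h2 : (∑' i, (φ i).smulRight (c i • d i)) (lp.single 2 i (1 : ℝ)) = c i • d i := by
    have h3 := hs.hasSum.mapL (ContinuousLinearMap.apply ℝ E
      (lp.single (E := fun _ : ℕ => ℝ) 2 i (1 : ℝ)))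
    have h4 := h3.unique (hasSum_single i fun k hk => ?_)
    · simpa [hφe, lp.single_apply_self] using h4
    · simp [hφe, hk]
  rw [map_smul, h2, smul_smul, inv_mul_cancel₀ (hc i).ne', one_smul]

/-- A pointwise measurable function with values in a separable dual is strongly measurable. -/
theorem stronglyMeasurable_dual_of_apply {Ω E : Type*} [MeasurableSpace Ω] [NormedAddCommGroup E]
    [NormedSpace ℝ E] [TopologicalSpace.SeparableSpace (StrongDual ℝ E)]
    {f : Ω → StrongDual ℝ E} (hf : ∀ x, Measurable fun a => f a x) : StronglyMeasurable f := by
  have := separableSpace_of_separableSpace_dual E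
  borelize (StrongDual ℝ E)
  have : SecondCountableTopology (StrongDual ℝ E) := UniformSpace.secondCountable_of_separable _
  refine Measurable.stronglyMeasurable ?_
  let d := TopologicalSpace.denseSeq E
  have hball : ∀ (g : StrongDual ℝ E) (r : ℝ), 0 ≤ r →
      MeasurableSet (f ⁻¹' Metric.closedBall g r) := by
    intro g r hr
    have : f ⁻¹' Metric.closedBall g r = ⋂ n, {a | ‖f a (d n) - g (d n)‖ ≤ r * ‖d n‖} := by
      ext a
      simp only [mem_preimage, Metric.mem_closedBall, mem_iInter, mem_ofPred_eq, dist_eq_norm]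
      constructor
      · intro h n
        exact ((f a - g).le_opNorm (d n)).trans (by gcongr)
      · intro h
        refine ContinuousLinearMap.opNorm_le_bound _ hr fun x => ?_
        refine (TopologicalSpace.denseRange_denseSeq E).induction_on
          (p := fun x => ‖(f a - g) x‖ ≤ r * ‖x‖) x ?_ (fun n => h n)
        exact isClosed_le (by fun_prop) (by fun_prop)
    rw [this]
    exact MeasurableSet.iInter fun n => measurableSet_le ((hf _).sub_const _).norm measurable_const
  refine measurable_of_isOpen fun s hs => ?_
  have hcov : ∀ x : s, ∃ r > 0, Metric.closedBall (x : StrongDual ℝ E) r ⊆ s := fun x =>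
    Metric.nhds_basis_closedBall.mem_iff.1 (hs.mem_nhds x.2)
  choose r hr hrs using hcov
  obtain ⟨t, ht, hts⟩ := TopologicalSpace.isOpen_iUnion_countable
    (fun x : s => Metric.ball (x : StrongDual ℝ E) (r x)) fun x => Metric.isOpen_ball
  have hs2 : s = ⋃ x ∈ t, Metric.closedBall (x : StrongDual ℝ E) (r x) := by
    apply subset_antisymm
    · intro y hy
      have : y ∈ ⋃ x : s, Metric.ball (x : StrongDual ℝ E) (r x) :=
        mem_iUnion.2 ⟨⟨y, hy⟩, Metric.mem_ball_self (hr _)⟩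
      rw [← hts] at this
      exact iUnion₂_mono (fun x _ => Metric.ball_subset_closedBall) this
    · exact iUnion₂_subset fun x _ => hrs x
  rw [hs2, preimage_iUnion₂]
  exact MeasurableSet.biUnion ht fun x _ => hball _ _ (hr x).le

section Representation

variable {Ω : Type*} [MeasurableSpace Ω] {μ : Measure Ω}

/-- The pairing of `L²(E*)` and `L²(E)`. -/
def lpDualPairing (μ : Measure Ω) (E : Type*) [NormedAddCommGroup E] [NormedSpace ℝ E] :
    Lp (StrongDual ℝ E) 2 μ →L[ℝ] Lp E 2 μ →L[ℝ] ℝ :=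
  (ContinuousLinearMap.id ℝ (StrongDual ℝ E)).lpPairing μ 2 2

theorem lpDualPairing_apply {E : Type*} [NormedAddCommGroup E] [NormedSpace ℝ E]
    (g : Lp (StrongDual ℝ E) 2 μ) (f : Lp E 2 μ) :
    lpDualPairing μ E g f = ∫ t, g t (f t) ∂μ :=
  ContinuousLinearMap.lpPairing_eq_integral _ _ _

theorem integrable_dual_apply {E : Type*} [NormedAddCommGroup E] [NormedSpace ℝ E]
    {g : Ω → StrongDual ℝ E} {f : Ω → E} (hg : MemLp g 2 μ) (hf : MemLp f 2 μ) :
    Integrable (fun t => g t (f t)) μ :=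
  memLp_one_iff_integrable.1
    ((ContinuousLinearMap.id ℝ (StrongDual ℝ E)).memLp_of_bilin 1 hg hf)

theorem norm_lpDualPairing_le {E : Type*} [NormedAddCommGroup E] [NormedSpace ℝ E]
    (g : Lp (StrongDual ℝ E) 2 μ) (f : Lp E 2 μ) :
    |lpDualPairing μ E g f| ≤ ‖g‖ * ‖f‖ := by
  have h1 : lpDualPairing μ E g f = L1.integralCLM' ℝ
      ((ContinuousLinearMap.id ℝ (StrongDual ℝ E)).holder 1 g f) := rfl
  have h2 : ‖(ContinuousLinearMap.id ℝ (StrongDual ℝ E)).holder (μ := μ) 1 g f‖ ≤ ‖g‖ * ‖f‖ := by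
    refine (ContinuousLinearMap.norm_holder_apply_apply_le _ g f).trans ?_
    gcongr
    exact mul_le_of_le_one_left (norm_nonneg _) ContinuousLinearMap.norm_id_le
  rw [h1, ← Real.norm_eq_abs]
  refine le_trans ?_ h2
  rw [← L1.integral_eq']
  exact L1.norm_integral_le _

variable {E F : Type*} [NormedAddCommGroup E] [NormedSpace ℝ E]
  [NormedAddCommGroup F] [InnerProductSpace ℝ F]

/-- Measurable selectors which nearly realise the dual norm of `f t` with respect to `‖j ·‖`. -/
theorem exists_selectors (j : F →L[ℝ] E) (y : ℕ → F) (hy : ∀ n, ‖j (y n)‖ ≤ 1) {f : Ω → F}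
    (hf : StronglyMeasurable f) :
    ∃ e : ℕ → Ω → F, ∀ n, StronglyMeasurable (e n) ∧ (∃ C, ∀ t, ‖e n t‖ ≤ C) ∧
      (∀ t, ‖j (e n t)‖ ≤ 1) ∧ (∀ t, 0 ≤ ⟪e n t, f t⟫_ℝ) ∧
      (∀ t, ⟪e n t, f t⟫_ℝ ≤ ⟪e (n + 1) t, f t⟫_ℝ) ∧
      ∀ t, ⟪y n, f t⟫_ℝ ≤ ⟪e (n + 1) t, f t⟫_ℝ := by
  let e : ℕ → Ω → F := fun n => Nat.rec (fun _ => 0)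
    (fun n g t => if ⟪g t, f t⟫_ℝ < ⟪y n, f t⟫_ℝ then y n else g t) n
  have e0 : ∀ t, e 0 t = 0 := fun t => rfl
  have es : ∀ n t, e (n + 1) t = if ⟪e n t, f t⟫_ℝ < ⟪y n, f t⟫_ℝ then y n else e n t :=
    fun n t => rfl
  refine ⟨e, fun n => ⟨?_, ?_, ?_, ?_, ?_, ?_⟩⟩
  · induction n with
    | zero => exact stronglyMeasurable_const
    | succ n ih =>
      have hm : MeasurableSet {t | ⟪e n t, f t⟫_ℝ < ⟪y n, f t⟫_ℝ} :=
        StronglyMeasurable.measurableSet_lt (ih.inner hf)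
          (StronglyMeasurable.inner stronglyMeasurable_const hf)
      exact StronglyMeasurable.ite hm stronglyMeasurable_const ih
  · induction n with
    | zero => exact ⟨0, fun t => by simp [e0]⟩
    | succ n ih =>
      obtain ⟨C, hC⟩ := ih
      refine ⟨max C ‖y n‖, fun t => ?_⟩
      rw [es]
      split_ifs
      · exact le_max_right _ _
      · exact (hC t).trans (le_max_left _ _)
  · intro t
    induction n with
    | zero => simp [e0]
    | succ n ih =>
      rw [es]
      split_ifs
      · exact hy n
      · exact ih
  · intro t
    induction n with
    | zero => simp [e0]
    | succ n ih =>
      rw [es]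
      split_ifs with h
      · exact ih.trans h.le
      · exact ih
  · intro t
    rw [es]
    split_ifs with h
    · exact h.le
    · exact le_rfl
  · intro t
    rw [es]
    split_ifs with h
    · exact le_rfl
    · exact not_lt.1 h

theorem lintegral_sq_selector_le (j : F →L[ℝ] E) (Φ : StrongDual ℝ (Lp E 2 μ))
    (f : Lp F 2 μ) (hf : ∀ ψ : Lp F 2 μ, ∫ t, ⟪ψ t, f t⟫_ℝ ∂μ = Φ (j.compLp ψ))
    {e : Ω → F} (he : StronglyMeasurable e) {C : ℝ} (hC : ∀ t, ‖e t‖ ≤ C)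
    (hj : ∀ t, ‖j (e t)‖ ≤ 1) :
    ∫⁻ t, ‖⟪e t, f t⟫_ℝ‖ₑ ^ 2 ∂μ ≤ ENNReal.ofReal (‖Φ‖ ^ 2) := by
  have hK : MemLp (fun t => ⟪e t, f t⟫_ℝ) 2 μ := by
    refine (Lp.memLp f).of_le_mul (c := C) ?_ ?_
    · exact (he.inner (Lp.stronglyMeasurable f)).aestronglyMeasurable
    · filter_upwards with t
      exact (norm_inner_le_norm _ _).trans (by gcongr; exact hC t)
  have hψ : MemLp (fun t => ⟪e t, f t⟫_ℝ • e t) 2 μ := by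
    refine hK.of_le_mul (c := C) ?_ ?_
    · exact ((he.inner (Lp.stronglyMeasurable f)).smul he).aestronglyMeasurable
    · filter_upwards with t
      rw [norm_smul, mul_comm]
      gcongr
      exact hC t
  let k := hK.toLp
  have h1 : ‖k‖ ^ 2 = ∫ t, ⟪e t, f t⟫_ℝ ^ 2 ∂μ := by
    rw [← real_inner_self_eq_norm_sq, L2.inner_def]
    refine integral_congr_ae ?_
    filter_upwards [hK.coeFn_toLp] with t ht
    simp only [k, ht]
    simp [sq]
  have h2 : ∫ t, ⟪e t, f t⟫_ℝ ^ 2 ∂μ = Φ (j.compLp hψ.toLp) := by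
    rw [← hf]
    refine integral_congr_ae ?_
    filter_upwards [hψ.coeFn_toLp] with t ht
    rw [ht, real_inner_smul_left, sq]
  have h3 : ‖j.compLp hψ.toLp‖ ≤ ‖k‖ := by
    refine Lp.norm_le_norm_of_ae_le ?_
    filter_upwards [hψ.coeFn_toLp, hK.coeFn_toLp, j.coeFn_compLp hψ.toLp] with t h1 h2 h3
    rw [h3, h1, h2, map_smul, norm_smul]
    exact mul_le_of_le_one_right (norm_nonneg _) (hj t)
  have h4 : ‖k‖ ^ 2 ≤ ‖Φ‖ * ‖k‖ := by
    rw [h1, h2]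
    exact (le_abs_self _).trans ((Φ.le_opNorm _).trans (by gcongr))
  have h5 : ‖k‖ ≤ ‖Φ‖ := by
    rcases eq_or_lt_of_le (norm_nonneg k) with h0 | h0
    · rw [← h0]; exact norm_nonneg _
    · nlinarith
  have h6 : ∫⁻ t, ‖⟪e t, f t⟫_ℝ‖ₑ ^ 2 ∂μ = ENNReal.ofReal (∫ t, ⟪e t, f t⟫_ℝ ^ 2 ∂μ) := by
    rw [ofReal_integral_eq_lintegral_ofReal hK.integrable_sq
      (Filter.Eventually.of_forall fun t => sq_nonneg _)]
    refine lintegral_congr fun t => ?_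
    rw [← ofReal_norm, ← ENNReal.ofReal_pow (norm_nonneg _), Real.norm_eq_abs, sq_abs]
  rw [h6, ← h1]
  exact ENNReal.ofReal_le_ofReal (by gcongr)

/-- Bounded functionals on `L²(E)` are represented by `L²(E*)` when `E*` is separable. -/
theorem exists_lpDualPairing_eq [CompleteSpace E] [TopologicalSpace.SeparableSpace (StrongDual ℝ E)]
    [IsFiniteMeasure μ] (Φ : StrongDual ℝ (Lp E 2 μ)) :
    ∃ g : Lp (StrongDual ℝ E) 2 μ, ‖g‖ ≤ ‖Φ‖ ∧ ∀ f, lpDualPairing μ E g f = Φ f := by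
  have := separableSpace_of_separableSpace_dual E
  obtain ⟨j, hj⟩ := exists_l2_denseRange E
  let F := lp (fun _ : ℕ => ℝ) 2
  have : SecondCountableTopology F := UniformSpace.secondCountable_of_separable _
  let f : Lp F 2 μ := (InnerProductSpace.toDual ℝ (Lp F 2 μ)).symm (Φ.comp (j.compLpL 2 μ))
  have hf : ∀ ψ : Lp F 2 μ, ∫ t, ⟪ψ t, f t⟫_ℝ ∂μ = Φ (j.compLp ψ) := by
    intro ψ
    rw [← L2.inner_def, real_inner_comm, InnerProductSpace.toDual_symm_apply]
    rfl
  let Y : Set F := {y | ‖j y‖ ≤ 1}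
  have : Nonempty Y := ⟨⟨0, by simp [Y]⟩⟩
  let y : ℕ → Y := TopologicalSpace.denseSeq Y
  have hyd : DenseRange y := TopologicalSpace.denseRange_denseSeq Y
  have hfm := Lp.stronglyMeasurable f
  obtain ⟨e, he⟩ := exists_selectors j (fun n => (y n : F)) (fun n => (y n).2) hfm
  have hem := fun n => (he n).1
  choose C hC using fun n => (he n).2.1
  have hej := fun n => (he n).2.2.1
  have he0 := fun n => (he n).2.2.2.1
  have hmono := fun n => (he n).2.2.2.2.1
  have hye := fun n => (he n).2.2.2.2.2
  let K : ℕ → Ω → ℝ≥0∞ := fun n t => ‖⟪e n t, f t⟫_ℝ‖ₑ ^ 2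
  have hKm : ∀ n, Measurable (K n) := fun n => ((hem n).inner hfm).enorm.pow_const 2
  have hKmono : Monotone K := by
    refine monotone_nat_of_le_succ fun n t => ?_
    simp only [K]
    gcongr 1
    rw [Real.enorm_of_nonneg (he0 _ _), Real.enorm_of_nonneg (he0 _ _)]
    exact ENNReal.ofReal_le_ofReal (hmono n t)
  let S : Ω → ℝ≥0∞ := fun t => ⨆ n, K n t
  have hSm : Measurable S := Measurable.iSup hKm
  have hSle : ∫⁻ t, S t ∂μ ≤ ENNReal.ofReal (‖Φ‖ ^ 2) := by
    rw [lintegral_iSup hKm hKmono]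
    exact iSup_le fun n => lintegral_sq_selector_le j Φ f hf (hem n) (hC n) (hej n)
  have hSfin : ∀ᵐ t ∂μ, S t < ⊤ :=
    ae_lt_top hSm (hSle.trans_lt ENNReal.ofReal_lt_top).ne
  let k : Ω → ℝ := fun t => √(S t).toReal
  have hbound : ∀ t, S t < ⊤ → ∀ h : F, |⟪f t, h⟫_ℝ| ≤ k t * ‖j h‖ := by
    intro t ht
    have h1 : ∀ n, ⟪(y n : F), f t⟫_ℝ ≤ k t := by
      intro n
      refine (hye n t).trans ?_
      refine Real.le_sqrt_of_sq_le ?_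
      have : K (n + 1) t ≤ S t := le_iSup (fun n => K n t) _
      have h2 := ENNReal.toReal_mono ht.ne this
      simp only [K, ENNReal.toReal_pow, toReal_enorm, Real.norm_eq_abs, sq_abs] at h2
      exact h2
    have h2 : ∀ z : Y, ⟪(z : F), f t⟫_ℝ ≤ k t := by
      intro z
      refine hyd.induction_on (p := fun z : Y => ⟪(z : F), f t⟫_ℝ ≤ k t) z ?_ h1
      exact isClosed_le (by fun_prop) continuous_const
    have h3 : ∀ h : F, ⟪h, f t⟫_ℝ ≤ k t * ‖j h‖ := by
      intro h
      refine le_of_forall_pos_le_add fun ε hε => ?_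
      have hk : 0 ≤ k t := Real.sqrt_nonneg _
      have hr : 0 < ‖j h‖ + ε / (k t + 1) := by positivity
      have hm : (‖j h‖ + ε / (k t + 1))⁻¹ • h ∈ Y := by
        simp only [Y, mem_ofPred_eq, map_smul, norm_smul, norm_inv, Real.norm_of_nonneg hr.le]
        rw [inv_mul_le_iff₀ hr, mul_one]
        have : 0 ≤ ε / (k t + 1) := by positivity
        linarith
      have h4 := h2 ⟨_, hm⟩
      rw [real_inner_smul_left, inv_mul_le_iff₀ hr] at h4
      have h5 : ε / (k t + 1) * k t ≤ ε := by
        rw [div_mul_eq_mul_div, div_le_iff₀ (by positivity)]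
        nlinarith
      linarith
    intro h
    rw [abs_le]
    have h4 := h3 h
    have h5 := h3 (-h)
    rw [inner_neg_left, map_neg, norm_neg] at h5
    rw [real_inner_comm]
    constructor <;> linarith
  classical
  let g : Ω → StrongDual ℝ E := fun t =>
    if S t < ⊤ then (innerSL ℝ (f t)).toLinearMap.extendOfNorm (j : F →ₗ[ℝ] E) else 0
  have hgj : ∀ t, S t < ⊤ → ∀ h, g t (j h) = ⟪f t, h⟫_ℝ := by
    intro t ht h
    simp only [g, if_pos ht]
    exact LinearMap.extendOfNorm_eq (f := (innerSL ℝ (f t)).toLinearMap) (e := (j : F →ₗ[ℝ] E)) hj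
      ⟨k t, hbound t ht⟩ h
  have hgn : ∀ t, ‖g t‖ ≤ k t := by
    intro t
    by_cases ht : S t < ⊤
    · refine ContinuousLinearMap.opNorm_le_bound _ (Real.sqrt_nonneg _) fun x => ?_
      simp only [g, if_pos ht]
      exact LinearMap.norm_extendOfNorm_apply_le (f := (innerSL ℝ (f t)).toLinearMap)
        (e := (j : F →ₗ[ℝ] E)) hj (k t) (hbound t ht) x
    · simp only [g, if_neg ht, norm_zero]
      exact Real.sqrt_nonneg _
  have hgm : StronglyMeasurable g := by
    refine stronglyMeasurable_dual_of_apply fun x => ?_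
    have hjm : ∀ h : F, Measurable fun t => g t (j h) := by
      intro h
      have : (fun t => g t (j h)) = {t | S t < ⊤}.indicator fun t => ⟪f t, h⟫_ℝ := by
        ext t
        by_cases ht : S t < ⊤
        · rw [hgj t ht, indicator_of_mem (by exact ht)]
        · rw [indicator_of_notMem (by exact ht)]
          simp [g, ht]
      rw [this]
      exact (hfm.inner stronglyMeasurable_const).measurable.indicator
        (measurableSet_lt hSm measurable_const)
    obtain ⟨u, hu, hux⟩ := mem_closure_iff_seq_limit.1 (hj x)
    choose h hh using hu
    refine measurable_of_tendsto_metrizable (fun n => hjm (h n)) ?_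
    rw [tendsto_pi_nhds]
    intro t
    simp only [hh]
    exact ((g t).continuous.tendsto x).comp hux
  have hgn2 : ∫⁻ t, ‖g t‖ₑ ^ 2 ∂μ ≤ ENNReal.ofReal (‖Φ‖ ^ 2) := by
    refine le_trans (lintegral_mono_ae ?_) hSle
    filter_upwards [hSfin] with t ht
    rw [← ENNReal.ofReal_toReal ht.ne, ← ofReal_norm,
      ← ENNReal.ofReal_pow (norm_nonneg _)]
    refine ENNReal.ofReal_le_ofReal ?_
    calc ‖g t‖ ^ 2 ≤ k t ^ 2 := by gcongr; exact hgn t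
      _ = _ := Real.sq_sqrt ENNReal.toReal_nonneg
  have hgle : eLpNorm g 2 μ ≤ ENNReal.ofReal ‖Φ‖ := by
    have h1 := eLpNorm_nnreal_pow_eq_lintegral (μ := μ) (f := g) (p := 2) (by simp)
    have h2 : eLpNorm g 2 μ ^ (2 : ℝ) ≤ ENNReal.ofReal ‖Φ‖ ^ (2 : ℝ) := by
      simp only [NNReal.coe_ofNat, ENNReal.coe_ofNat] at h1
      rw [h1]
      simp only [ENNReal.rpow_ofNat, ← ENNReal.ofReal_pow (norm_nonneg _)]
      exact hgn2
    exact (ENNReal.rpow_le_rpow_iff (by norm_num)).1 h2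
  have hgL : MemLp g 2 μ := ⟨hgm.aestronglyMeasurable, hgle.trans_lt ENNReal.ofReal_lt_top⟩
  refine ⟨hgL.toLp, ?_, ?_⟩
  · rw [Lp.norm_toLp]
    exact ENNReal.toReal_le_of_le_ofReal (norm_nonneg _) hgle
  · have hclosed : IsClosed {f : Lp E 2 μ | lpDualPairing μ E hgL.toLp f = Φ f} :=
      isClosed_eq (ContinuousLinearMap.continuous _) Φ.continuous
    have hcomp : ∀ ψ : Lp F 2 μ, lpDualPairing μ E hgL.toLp (j.compLp ψ) = Φ (j.compLp ψ) := by
      intro ψ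
      rw [lpDualPairing_apply, ← hf]
      refine integral_congr_ae ?_
      filter_upwards [hgL.coeFn_toLp, j.coeFn_compLp ψ, hSfin] with t h1 h2 h3
      rw [h1, h2, hgj t h3, real_inner_comm]
    have hind : ∀ (c : E) {s : Set Ω} (hs : MeasurableSet s) (hμs : μ s ≠ ⊤),
        lpDualPairing μ E hgL.toLp (indicatorConstLp 2 hs hμs c) =
          Φ (indicatorConstLp 2 hs hμs c) := by
      intro c s hs hμs
      have hcont : Continuous fun c : E => indicatorConstLp (μ := μ) 2 hs hμs c := by
        refine continuous_iff_continuousAt.2 fun c => ?_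
        rw [ContinuousAt, tendsto_iff_dist_tendsto_zero]
        have h1 : ∀ d : E, dist (indicatorConstLp (μ := μ) 2 hs hμs d)
            (indicatorConstLp 2 hs hμs c) = ‖d - c‖ * μ.real s ^ (1 / (2 : ℝ)) := by
          intro d
          rw [dist_eq_norm, indicatorConstLp_sub, norm_indicatorConstLp (by simp) (by simp)]
          simp
        simp only [h1]
        have : Continuous fun d : E => ‖d - c‖ * μ.real s ^ (1 / (2 : ℝ)) := by fun_prop
        simpa using this.tendsto c
      refine hj.induction_on (p := fun c => lpDualPairing μ E hgL.toLp
        (indicatorConstLp 2 hs hμs c) = Φ (indicatorConstLp 2 hs hμs c)) c ?_ fun h => ?_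
      · exact isClosed_eq ((ContinuousLinearMap.continuous _).comp hcont)
          (Φ.continuous.comp hcont)
      · have : indicatorConstLp (μ := μ) 2 hs hμs (j h) =
            j.compLp (indicatorConstLp 2 hs hμs h) := by
          refine Lp.ext ?_
          filter_upwards [j.coeFn_compLp (indicatorConstLp (μ := μ) 2 hs hμs h),
            indicatorConstLp_coeFn (p := 2) (hs := hs) (hμs := hμs) (c := h),
            indicatorConstLp_coeFn (p := 2) (hs := hs) (hμs := hμs) (c := j h)] with t h1 h2 h3
          rw [h1, h2, h3]
          by_cases ht : t ∈ s <;> simp [ht]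
        rw [this, hcomp]
    intro φ
    refine Lp.induction (by simp) (fun φ => lpDualPairing μ E hgL.toLp φ = Φ φ) ?_ ?_ hclosed φ
    · intro c s hs hμs
      rw [Lp.simpleFunc.coe_indicatorConst]
      exact hind c hs hμs.ne
    · intro φ ψ hφ hψ _ h1 h2
      rw [map_add, map_add, h1, h2]

end Representation

section Translation

variable {E : Type*} [NormedAddCommGroup E]

/-- Translation is continuous in `L²(ℝ; E)`. -/
theorem tendsto_eLpNorm_translate_sub {f : ℝ → E} (hf : MemLp f 2 volume) :
    Tendsto (fun h : ℝ => eLpNorm (fun t => f (t + h) - f t) 2 volume) (𝓝 0) (𝓝 0) := by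
  have : Fact ((2 : ℝ≥0∞) ≠ ⊤) := ⟨by simp⟩
  let F := hf.toLp
  have hc : Continuous fun h : ℝ => (DomAddAct.mk h +ᵥ F : Lp E 2 (volume : Measure ℝ)) :=
    Continuous.vadd DomAddAct.continuous_mk continuous_const
  have h1 := hc.tendsto 0
  rw [tendsto_iff_edist_tendsto_0] at h1
  refine h1.congr fun h => ?_
  have h0 : (DomAddAct.mk (0 : ℝ) +ᵥ F : Lp E 2 (volume : Measure ℝ)) = F := by
    rw [DomAddAct.mk_zero, zero_vadd]
  rw [h0, Lp.edist_def]
  refine eLpNorm_congr_ae ?_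
  have hq : ∀ᵐ t : ℝ, F (t + h) = f (t + h) :=
    (measurePreserving_add_right volume h).quasiMeasurePreserving.ae hf.coeFn_toLp
  filter_upwards [DomAddAct.vadd_Lp_ae_eq (DomAddAct.mk h) F, hf.coeFn_toLp, hq] with t h1 h2 h3
  simp only [Pi.sub_apply]
  rw [h1, h2, Equiv.symm_apply_apply, vadd_eq_add, add_comm h t, h3]

variable [NormedSpace ℝ E] [CompleteSpace E]

theorem enorm_steklov_sub_sq_le {f : ℝ → E} (hf : LocallyIntegrable f volume) {h : ℝ}
    (hh : 0 < h) (t : ℝ) :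
    ‖h⁻¹ • (∫ r in t..t + h, f r) - f t‖ₑ ^ 2 ≤
      ∫⁻ θ in Ioc (0 : ℝ) 1, ‖f (t + h * θ) - f t‖ₑ ^ 2 := by
  have hint : IntervalIntegrable (fun θ => f (t + h * θ)) volume 0 1 := by
    have h1 : IntervalIntegrable f volume (t + h * 0) (t + h * 1) := (hf.integrableOn_isCompact isCompact_uIcc).intervalIntegrable
    have := (h1.comp_add_left t).comp_mul_left (c := h)
    simpa [hh.ne'] using this
  have h1 : h⁻¹ • (∫ r in t..t + h, f r) - f t =
      ∫ θ in Ioc (0 : ℝ) 1, (f (t + h * θ) - f t) := by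
    rw [← intervalIntegral.integral_of_le zero_le_one,
      intervalIntegral.integral_sub hint intervalIntegrable_const,
      intervalIntegral.integral_comp_add_mul _ hh.ne']
    simp
  let ν : Measure ℝ := volume.restrict (Ioc 0 1)
  have hν : IsProbabilityMeasure ν := ⟨by simp [ν]⟩
  have hm : AEStronglyMeasurable (fun θ => f (t + h * θ) - f t) ν :=
    (hint.aestronglyMeasurable.sub aestronglyMeasurable_const)
  have h2 := eLpNorm_le_eLpNorm_of_exponent_le (p := 1) (q := 2) (by norm_num) hm
  have h3 := eLpNorm_nnreal_pow_eq_lintegral (μ := ν) (f := fun θ => f (t + h * θ) - f t)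
    (p := 2) (by simp)
  simp only [NNReal.coe_ofNat, ENNReal.coe_ofNat, ENNReal.rpow_ofNat] at h3
  rw [h1, ← h3]
  gcongr
  refine (enorm_integral_le_lintegral_enorm _).trans ?_
  rw [← eLpNorm_one_eq_lintegral_enorm]
  exact h2

/-- Steklov averages converge in `L²(ℝ; E)`. -/
theorem tendsto_eLpNorm_steklov_sub {f : ℝ → E} (hfm : StronglyMeasurable f)
    (hf : MemLp f 2 volume) :
    Tendsto (fun h : ℝ => eLpNorm (fun t => h⁻¹ • (∫ r in t..t + h, f r) - f t) 2 volume)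
      (𝓝[>] 0) (𝓝 0) := by
  rw [ENNReal.tendsto_nhds_zero]
  intro ε hε
  have h1 := tendsto_eLpNorm_translate_sub hf
  rw [ENNReal.tendsto_nhds_zero] at h1
  obtain ⟨δ, hδ, hδ2⟩ := Metric.eventually_nhds_iff.1 (h1 ε hε)
  filter_upwards [Ioo_mem_nhdsGT hδ] with h hh
  have hsq : ∀ w : ℝ → E, eLpNorm w 2 volume ^ (2 : ℝ) = ∫⁻ t, ‖w t‖ₑ ^ 2 := by
    intro w
    have h3 := eLpNorm_nnreal_pow_eq_lintegral (μ := volume) (f := w) (p := 2) (by simp)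
    simpa only [NNReal.coe_ofNat, ENNReal.coe_ofNat, ENNReal.rpow_ofNat] using h3
  refine (ENNReal.rpow_le_rpow_iff (z := 2) (by norm_num)).1 ?_
  rw [hsq]
  calc ∫⁻ t, ‖h⁻¹ • (∫ r in t..t + h, f r) - f t‖ₑ ^ 2
      ≤ ∫⁻ t, ∫⁻ θ in Ioc (0 : ℝ) 1, ‖f (t + h * θ) - f t‖ₑ ^ 2 :=
        lintegral_mono fun t => enorm_steklov_sub_sq_le (hf.locallyIntegrable (by norm_num)) hh.1 t
    _ = ∫⁻ θ in Ioc (0 : ℝ) 1, ∫⁻ t, ‖f (t + h * θ) - f t‖ₑ ^ 2 := by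
        refine lintegral_lintegral_swap (Measurable.aemeasurable ?_)
        refine Measurable.pow_const (StronglyMeasurable.enorm ?_) 2
        exact (hfm.comp_measurable (by fun_prop)).sub (hfm.comp_measurable measurable_fst)
    _ ≤ ∫⁻ θ in Ioc (0 : ℝ) 1, ε ^ (2 : ℝ) := by
        refine setLIntegral_mono measurable_const fun θ hθ => ?_
        rw [← hsq]
        gcongr
        refine hδ2 ?_
        rw [Real.dist_eq, sub_zero, abs_of_nonneg (mul_nonneg hh.1.le hθ.1.le)]
        calc h * θ ≤ h * 1 := by gcongr; exacts [hh.1.le, hθ.2]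
          _ < δ := by simpa using hh.2
    _ = ε ^ (2 : ℝ) := by simp

end Translation

section DuBoisReymond

variable {E : Type*} [NormedAddCommGroup E] [NormedSpace ℝ E] [CompleteSpace E]

theorem integral_deriv_smul_primitive {T : ℝ} (hT : 0 < T) {g : ℝ → E}
    (hg : IntegrableOn g (Icc 0 T)) {φ : ℝ → ℝ} (hφ : ContDiff ℝ ∞ φ)
    (hsupp : tsupport φ ⊆ Ioo 0 T) :
    ∫ t in Icc 0 T, deriv φ t • (∫ r in (0 : ℝ)..t, g r) = -∫ t in Icc 0 T, φ t • g t := by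
  have hgi : IntervalIntegrable g volume 0 T :=
    (intervalIntegrable_iff_integrableOn_Icc_of_le hT.le).2 hg
  have hP : ContinuousOn (fun t => ∫ r in (0 : ℝ)..t, g r) (Icc 0 T) := by
    have := intervalIntegral.continuousOn_primitive_interval' hgi (left_mem_uIcc)
    rwa [uIcc_of_le hT.le] at this
  have hφ1 : ContDiff ℝ 1 φ := hφ.of_le (by exact_mod_cast le_top)
  have hφ' : Continuous (deriv φ) := hφ1.continuous_deriv le_rfl
  have hi1 : IntegrableOn (fun t => deriv φ t • (∫ r in (0 : ℝ)..t, g r)) (Icc 0 T) :=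
    (hφ'.continuousOn.smul hP).integrableOn_Icc
  have hi2 : IntegrableOn (fun t => φ t • g t) (Icc 0 T) :=
    hg.continuousOn_smul hφ.continuous.continuousOn isCompact_Icc
  refine (SeparatingDual.eq_iff_forall_dual_eq (R := ℝ)).2 fun ℓ => ?_
  have hℓg : IntervalIntegrable (fun t => ℓ (g t)) volume 0 T :=
    ⟨ℓ.integrable_comp hgi.1, ℓ.integrable_comp hgi.2⟩
  rw [map_neg, ← ℓ.integral_comp_comm hi1, ← ℓ.integral_comp_comm hi2]
  simp only [map_smul, smul_eq_mul]
  rw [integral_Icc_eq_integral_Ioc, integral_Icc_eq_integral_Ioc,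
    ← intervalIntegral.integral_of_le hT.le, ← intervalIntegral.integral_of_le hT.le]
  have hac1 : AbsolutelyContinuousOnInterval (fun t => ∫ r in (0 : ℝ)..t, ℓ (g r)) 0 T :=
    hℓg.absolutelyContinuousOnInterval_intervalIntegral left_mem_uIcc
  have hac2 : AbsolutelyContinuousOnInterval φ 0 T := hφ1.contDiffOn.absolutelyContinuousOnInterval
  have h0 : φ 0 = 0 := image_eq_zero_of_notMem_tsupport fun h => lt_irrefl _ (hsupp h).1
  have hT0 : φ T = 0 := image_eq_zero_of_notMem_tsupport fun h => lt_irrefl _ (hsupp h).2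
  have key := hac1.integral_mul_deriv_eq_deriv_mul hac2
  rw [h0, hT0, mul_zero, mul_zero, sub_zero, zero_sub] at key
  have e1 : ∫ t in (0 : ℝ)..T, deriv φ t * ℓ (∫ r in (0 : ℝ)..t, g r) =
      ∫ t in (0 : ℝ)..T, (∫ r in (0 : ℝ)..t, ℓ (g r)) * deriv φ t := by
    refine intervalIntegral.integral_congr fun t ht => ?_
    rw [uIcc_of_le hT.le] at ht
    rw [ContinuousLinearMap.intervalIntegral_comp_comm, mul_comm]
    exact hgi.mono_set (by rw [uIcc_of_le hT.le, uIcc_of_le ht.1]; exact Icc_subset_Icc_right ht.2)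
  rw [e1, key]
  congr 1
  refine intervalIntegral.integral_congr_ae ?_
  filter_upwards [hℓg.ae_hasDerivAt_integral] with t ht htm
  rw [(ht (uIoc_subset_uIcc htm) 0 left_mem_uIcc).deriv, mul_comm]

/-- A primitive of a compactly supported smooth function of integral zero. -/
theorem exists_primitive_of_integral_eq_zero {T : ℝ} {ψ : ℝ → ℝ} (hψ : ContDiff ℝ ∞ ψ)
    (hc : HasCompactSupport ψ) (hsupp : tsupport ψ ⊆ Ioo 0 T) (h0 : ∫ t, ψ t = 0) :
    ∃ φ : ℝ → ℝ, ContDiff ℝ ∞ φ ∧ HasCompactSupport φ ∧ tsupport φ ⊆ Ioo 0 T ∧ deriv φ = ψ := by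
  rcases (tsupport ψ).eq_empty_or_nonempty with he | hne
  · refine ⟨0, contDiff_const, HasCompactSupport.zero, by simp [tsupport], ?_⟩
    rw [tsupport_eq_empty_iff] at he
    rw [he]
    ext t
    simp
  obtain ⟨a, ha, ha'⟩ := hc.isCompact.exists_isLeast hne
  obtain ⟨b, hb, hb'⟩ := hc.isCompact.exists_isGreatest hne
  have hz : ∀ t, t ∉ Icc a b → ψ t = 0 := fun t ht =>
    image_eq_zero_of_notMem_tsupport fun h => ht ⟨ha' h, hb' h⟩
  have hd : ∀ t, HasDerivAt (fun t => ∫ r in a..t, ψ r) (ψ t) t := fun t =>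
    intervalIntegral.integral_hasDerivAt_right (hψ.continuous.intervalIntegrable _ _)
      (hψ.continuous.stronglyMeasurableAtFilter _ _) hψ.continuous.continuousAt
  have hderiv : deriv (fun t => ∫ r in a..t, ψ r) = ψ := funext fun t => (hd t).deriv
  have hsub : Function.support (fun t => ∫ r in a..t, ψ r) ⊆ Icc a b := by
    intro t ht
    by_contra hcon
    refine ht ?_
    rcases lt_or_ge t a with h | h
    · refine intervalIntegral.integral_zero_ae ?_
      have : ∀ᵐ r : ℝ, r ≠ a := by simp [ae_iff]
      filter_upwards [this] with r hr hrm
      rw [uIoc_of_ge h.le] at hrm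
      exact hz r fun hr2 => hr (le_antisymm hrm.2 hr2.1)
    · have htb : b < t := not_le.1 fun h2 => hcon ⟨h, h2⟩
      have hzt : ∀ r, r ∉ Icc a t → ψ r = 0 := fun r hr =>
        hz r fun h2 => hr ⟨h2.1, h2.2.trans htb.le⟩
      have e1 : ∫ r, ψ r = ∫ r in Icc a t, ψ r :=
        (setIntegral_eq_integral_of_forall_compl_eq_zero hzt).symm
      beta_reduce
      rw [intervalIntegral.integral_of_le h, ← integral_Icc_eq_integral_Ioc, ← e1, h0]
  have hts : tsupport (fun t => ∫ r in a..t, ψ r) ⊆ Icc a b :=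
    closure_minimal hsub isClosed_Icc
  refine ⟨fun t => ∫ r in a..t, ψ r, ?_, ?_, ?_, hderiv⟩
  · rw [contDiff_infty_iff_deriv, hderiv]
    exact ⟨fun t => (hd t).differentiableAt, hψ⟩
  · exact isCompact_Icc.of_isClosed_subset (isClosed_tsupport _) hts
  · exact hts.trans fun t ht => ⟨(hsupp ha).1.trans_le ht.1, ht.2.trans_lt (hsupp hb).2⟩

theorem exists_contDiff_integral_eq_one {T : ℝ} (hT : 0 < T) :
    ∃ φ : ℝ → ℝ, ContDiff ℝ ∞ φ ∧ HasCompactSupport φ ∧ tsupport φ ⊆ Ioo 0 T ∧ ∫ t, φ t = 1 := by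
  let b : ContDiffBump (T / 2) := ⟨T / 8, T / 4, by positivity, by linarith⟩
  refine ⟨b.normed volume, b.contDiff_normed, b.hasCompactSupport_normed, ?_, b.integral_normed⟩
  rw [b.tsupport_normed_eq, Real.closedBall_eq_Icc]
  intro t ht
  simp only [b] at ht
  constructor
  · linarith [ht.1]
  · linarith [ht.2]

/-- A function with integrable weak derivative `g` is a.e. a primitive of `g`. -/
theorem HasWeakTimeDeriv.exists_eq_primitive {T : ℝ} (hT : 0 < T) {u g : ℝ → E}
    (h : HasWeakTimeDeriv T u g) :
    ∃ c : E, ∀ᵐ t, t ∈ Ioo 0 T → u t = c + ∫ r in (0 : ℝ)..t, g r := by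
  obtain ⟨hu, hg, hw⟩ := h
  have hgi : IntervalIntegrable g volume 0 T :=
    (intervalIntegrable_iff_integrableOn_Icc_of_le hT.le).2 hg
  have hP : ContinuousOn (fun t => ∫ r in (0 : ℝ)..t, g r) (Icc 0 T) := by
    have := intervalIntegral.continuousOn_primitive_interval' hgi (left_mem_uIcc)
    rwa [uIcc_of_le hT.le] at this
  let z : ℝ → E := fun t => u t - ∫ r in (0 : ℝ)..t, g r
  have hz : IntegrableOn z (Icc 0 T) := hu.sub hP.integrableOn_Icc
  have hzφ : ∀ φ : ℝ → ℝ, ContDiff ℝ ∞ φ → HasCompactSupport φ → tsupport φ ⊆ Ioo 0 T →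
      ∫ t in Icc 0 T, deriv φ t • z t = 0 := by
    intro φ hφ hc hs
    have hφ1 : ContDiff ℝ 1 φ := hφ.of_le (by exact_mod_cast le_top)
    have hφ' : Continuous (deriv φ) := hφ1.continuous_deriv le_rfl
    simp only [z, smul_sub]
    have i1 : IntegrableOn (fun t => deriv φ t • u t) (Icc 0 T) :=
      hu.continuousOn_smul hφ'.continuousOn isCompact_Icc
    have i2 : IntegrableOn (fun t => deriv φ t • ∫ r in (0 : ℝ)..t, g r) (Icc 0 T) :=
      (hφ'.continuousOn.smul hP).integrableOn_Icc
    rw [integral_sub i1 i2, hw φ hφ hc hs,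
      integral_deriv_smul_primitive hT hg hφ hs, sub_self]
  obtain ⟨φ₀, h1, h2, h3, h4⟩ := exists_contDiff_integral_eq_one hT
  let c : E := ∫ t in Icc 0 T, φ₀ t • z t
  refine ⟨c, ?_⟩
  have hloc : LocallyIntegrableOn (fun t => z t - c) (Ioo 0 T) volume :=
    ((hz.mono_set Ioo_subset_Icc_self).sub (integrableOn_const (by simp))).locallyIntegrableOn
  have key := isOpen_Ioo.ae_eq_zero_of_integral_contDiff_smul_eq_zero hloc fun ψ hψ hψc hψs => ?_
  · filter_upwards [key] with t ht htm
    have := ht htm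
    simp only [z] at this
    rw [← sub_eq_zero, ← this]
    abel
  · have hIcc : ∀ {χ : ℝ → ℝ}, tsupport χ ⊆ Ioo 0 T → ∀ t, t ∉ Icc 0 T → χ t = 0 :=
      fun hχ t ht => image_eq_zero_of_notMem_tsupport fun h => ht (Ioo_subset_Icc_self (hχ h))
    have hψi : Integrable ψ := hψ.continuous.integrable_of_hasCompactSupport hψc
    have hφi : Integrable φ₀ := h1.continuous.integrable_of_hasCompactSupport h2
    let m : ℝ := ∫ t, ψ t
    have hχts : tsupport (ψ - m • φ₀) ⊆ Ioo 0 T :=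
      (tsupport_sub _ _).trans (union_subset hψs ((tsupport_smul_subset_right (fun _ => m) φ₀).trans h3))
    obtain ⟨φ, hφ1, hφ2, hφ3, hφ4⟩ := exists_primitive_of_integral_eq_zero (T := T)
      (ψ := ψ - m • φ₀) (hψ.sub (contDiff_const.smul h1)) (hψc.sub h2.smul_left) hχts (by
        simp only [Pi.sub_apply, Pi.smul_apply]
        have hmi : Integrable (fun t => m • φ₀ t) := hφi.smul m
        rw [integral_sub hψi hmi, integral_smul, h4]
        simp [m])
    have h5 := hzφ φ hφ1 hφ2 hφ3
    rw [hφ4] at h5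
    have i1 : IntegrableOn (fun t => ψ t • z t) (Icc 0 T) :=
      hz.continuousOn_smul hψ.continuous.continuousOn isCompact_Icc
    have i2 : IntegrableOn (fun t => φ₀ t • z t) (Icc 0 T) :=
      hz.continuousOn_smul h1.continuous.continuousOn isCompact_Icc
    have i3 : IntegrableOn (fun t => ψ t • c) (Icc 0 T) :=
      (hψ.continuous.smul continuous_const).continuousOn.integrableOn_Icc
    have h6 : ∫ t in Icc 0 T, (ψ - m • φ₀) t • z t = (∫ t in Icc 0 T, ψ t • z t) - m • c := by
      simp only [Pi.sub_apply, Pi.smul_apply, sub_smul, smul_assoc]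
      have i4 : IntegrableOn (fun t => m • φ₀ t • z t) (Icc 0 T) := i2.smul m
      rw [integral_sub i1 i4, integral_smul]
    have h7 : ∫ t in Icc 0 T, ψ t • c = m • c := by
      rw [integral_smul_const, setIntegral_eq_integral_of_forall_compl_eq_zero (hIcc hψs)]
    rw [← setIntegral_eq_integral_of_forall_compl_eq_zero (s := Icc 0 T)
      fun t ht => by rw [hIcc hψs t ht, zero_smul]]
    simp only [smul_sub]
    rw [integral_sub i1 i3, h7, ← h6, h5]

end DuBoisReymond

theorem tendsto_dual_apply {E κ : Type*} [NormedAddCommGroup E] [NormedSpace ℝ E] {l : Filter κ}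
    {L : κ → StrongDual ℝ E} {L₀ : StrongDual ℝ E} {x : κ → E} {x₀ : E}
    (hL : Tendsto L l (𝓝 L₀)) (hx : Tendsto x l (𝓝 x₀)) :
    Tendsto (fun i => L i (x i)) l (𝓝 (L₀ x₀)) :=
  (isBoundedBilinearMap_apply.continuous.tendsto (L₀, x₀)).comp (hL.prodMk_nhds hx)

theorem tendsto_integral_dual_apply {Ω E κ : Type*} [MeasurableSpace Ω] {μ : Measure Ω}
    [NormedAddCommGroup E] [NormedSpace ℝ E] {l : Filter κ}
    {G : κ → Ω → StrongDual ℝ E} {g : Ω → StrongDual ℝ E} {W : κ → Ω → E} {w : Ω → E}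
    (hGi : ∀ i, MemLp (G i) 2 μ) (hg : MemLp g 2 μ) (hWi : ∀ i, MemLp (W i) 2 μ) (hw : MemLp w 2 μ)
    (hG : Tendsto (fun i => eLpNorm (G i - g) 2 μ) l (𝓝 0))
    (hW : Tendsto (fun i => eLpNorm (W i - w) 2 μ) l (𝓝 0)) :
    Tendsto (fun i => ∫ t, G i t (W i t) ∂μ) l (𝓝 (∫ t, g t (w t) ∂μ)) := by
  have key : ∀ {G : Ω → StrongDual ℝ E} {W : Ω → E} (hG : MemLp G 2 μ) (hW : MemLp W 2 μ),
      ∫ t, G t (W t) ∂μ = lpDualPairing μ E hG.toLp hW.toLp := by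
    intro G W hG hW
    rw [lpDualPairing_apply]
    refine integral_congr_ae ?_
    filter_upwards [hG.coeFn_toLp, hW.coeFn_toLp] with t h1 h2
    rw [h1, h2]
  rw [key hg hw]
  simp only [fun i => key (hGi i) (hWi i)]
  have h1 := (Lp.tendsto_Lp_iff_tendsto_eLpNorm'' _ hGi _ hg).2 hG
  have h2 := (Lp.tendsto_Lp_iff_tendsto_eLpNorm'' _ hWi _ hw).2 hW
  exact tendsto_dual_apply (((lpDualPairing μ E).continuous.tendsto _).comp h1) h2

section Energy

variable {V H : Type*} [NormedAddCommGroup V] [NormedSpace ℝ V]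
  [NormedAddCommGroup H] [InnerProductSpace ℝ H]

theorem toVDual_apply (ι : V →L[ℝ] H) (h : H) (v : V) : toVDual ι h v = ⟪h, ι v⟫_ℝ := rfl

theorem toVDual_sub (ι : V →L[ℝ] H) (h k : H) : toVDual ι (h - k) = toVDual ι h - toVDual ι k := by
  ext v
  simp [toVDual_apply, inner_sub_left]

theorem normSq_sub_normSq_eq (ι : V →L[ℝ] H) {T : ℝ} {f : ℝ → V} (hf : MemLp f 2 volume)
    {g : ℝ → StrongDual ℝ V} (hgm : StronglyMeasurable g) (hg : MemLp g 2 volume)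
    {y : ℝ → StrongDual ℝ V}
    (hy : ∀ s ∈ Icc 0 T, ∀ t ∈ Icc 0 T, y t - y s = ∫ r in s..t, g r)
    (hyf : ∀ᵐ t, t ∈ Ioo 0 T → toVDual ι (ι (f t)) = y t) {a b : ℝ}
    (ha : a ∈ Ioo 0 T) (hb : b ∈ Ioo 0 T) (hab : a ≤ b)
    (hda : HasDerivAt (fun x => ∫ r in (0 : ℝ)..x, ‖ι (f r)‖ ^ 2) (‖ι (f a)‖ ^ 2) a)
    (hdb : HasDerivAt (fun x => ∫ r in (0 : ℝ)..x, ‖ι (f r)‖ ^ 2) (‖ι (f b)‖ ^ 2) b) :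
    ‖ι (f b)‖ ^ 2 - ‖ι (f a)‖ ^ 2 = 2 * ∫ r in a..b, g r (f r) := by
  let N : ℝ → ℝ := fun t => ‖ι (f t)‖ ^ 2
  have hN : LocallyIntegrable N volume := by
    have : MemLp (fun t => ‖ι (f t)‖) 2 volume := (ι.comp_memLp' hf).norm
    exact this.integrable_sq.locallyIntegrable
  have hNi : ∀ x z, IntervalIntegrable N volume x z := fun x z =>
    (hN.integrableOn_isCompact isCompact_uIcc).intervalIntegrable
  have hgi : ∀ x z, IntervalIntegrable g volume x z := fun x z =>
    ((hg.locallyIntegrable (by norm_num)).integrableOn_isCompact isCompact_uIcc).intervalIntegrable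
  let P : ℝ → ℝ := fun x => ∫ r in (0 : ℝ)..x, N r
  let D : ℝ → ℝ → StrongDual ℝ V := fun h t => h⁻¹ • ∫ r in t..t + h, g r
  let W : ℝ → ℝ → V := fun h t => f (t + h) + f t
  let ν : Measure ℝ := volume.restrict (Icc a b)
  have hνle : ν ≤ volume := Measure.restrict_le_self
  have hD : ∀ h, MemLp (D h) 2 ν := by
    intro h
    have hc : Continuous (D h) := by
      have h1 : D h = fun t => h⁻¹ • ((∫ r in (0 : ℝ)..t + h, g r) - ∫ r in (0 : ℝ)..t, g r) := by
        ext1 t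
        simp only [D]
        rw [intervalIntegral.integral_interval_sub_left (hgi _ _) (hgi _ _)]
      have h2 : Continuous fun t => ∫ r in (0 : ℝ)..t, g r :=
        intervalIntegral.continuous_primitive hgi 0
      rw [h1]
      exact ((h2.comp (continuous_add_const h)).sub h2).const_smul h⁻¹
    obtain ⟨C, hC⟩ := isCompact_Icc.exists_bound_of_continuousOn (s := Icc a b) hc.continuousOn
    refine MemLp.of_bound hc.aestronglyMeasurable C ?_
    exact (ae_restrict_mem measurableSet_Icc).mono hC
  have hfh : ∀ h, MemLp (fun t => f (t + h)) 2 volume := fun h =>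
    hf.comp_measurePreserving (measurePreserving_add_right volume h)
  have hW : ∀ h, MemLp (W h) 2 ν := fun h => ((hfh h).add hf).mono_measure hνle
  have lim1 : Tendsto (fun h => ∫ t, D h t (W h t) ∂ν) (𝓝[>] 0)
      (𝓝 (∫ t, g t ((2 : ℝ) • f t) ∂ν)) := by
    refine tendsto_integral_dual_apply hD (hg.mono_measure hνle) hW
      ((hf.const_smul (2 : ℝ)).mono_measure hνle) ?_ ?_
    · exact tendsto_of_tendsto_of_tendsto_of_le_of_le tendsto_const_nhds
        (tendsto_eLpNorm_steklov_sub hgm hg) (fun _ => zero_le) fun h => eLpNorm_mono_measure _ hνle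
    · have h1 := (tendsto_eLpNorm_translate_sub hf).mono_left (nhdsWithin_le_nhds (s := Ioi 0))
      refine tendsto_of_tendsto_of_tendsto_of_le_of_le tendsto_const_nhds h1 (fun _ => zero_le)
        fun h => ?_
      refine le_trans (le_of_eq (eLpNorm_congr_ae ?_)) (eLpNorm_mono_measure _ hνle)
      filter_upwards with t
      simp only [W, Pi.sub_apply, two_smul]
      abel
  have lim2 : Tendsto (fun h => h⁻¹ • (P (b + h) - P b) - h⁻¹ • (P (a + h) - P a)) (𝓝[>] 0)
      (𝓝 (N b - N a)) := hdb.tendsto_slope_zero_right.sub hda.tendsto_slope_zero_right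
  have hEq : ∀ᶠ h in 𝓝[>] (0 : ℝ), h⁻¹ • (P (b + h) - P b) - h⁻¹ • (P (a + h) - P a) =
      ∫ t, D h t (W h t) ∂ν := by
    filter_upwards [Ioo_mem_nhdsGT (sub_pos.2 hb.2)] with h hh
    have e1 : P (b + h) - P b - (P (a + h) - P a) = ∫ t in a..b, (N (t + h) - N t) := by
      rw [intervalIntegral.integral_sub (by simpa using (hNi (a + h) (b + h)).comp_add_right h)
        (hNi a b), intervalIntegral.integral_comp_add_right]
      simp only [P]
      rw [← intervalIntegral.integral_interval_sub_left (hNi 0 (b + h)) (hNi 0 (a + h)),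
        ← intervalIntegral.integral_interval_sub_left (hNi 0 b) (hNi 0 a)]
      ring
    rw [← smul_sub, e1, ← intervalIntegral.integral_smul, intervalIntegral.integral_of_le hab,
      ← integral_Icc_eq_integral_Ioc]
    refine integral_congr_ae ?_
    have hyf' : ∀ᵐ t : ℝ, t + h ∈ Ioo 0 T → toVDual ι (ι (f (t + h))) = y (t + h) :=
      (measurePreserving_add_right volume h).quasiMeasurePreserving.ae hyf
    filter_upwards [ae_restrict_of_ae hyf, ae_restrict_of_ae hyf',
      ae_restrict_mem measurableSet_Icc] with t h1 h2 ht
    have ht1 : t ∈ Ioo 0 T := ⟨ha.1.trans_le ht.1, ht.2.trans_lt hb.2⟩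
    have ht2 : t + h ∈ Ioo 0 T := ⟨by linarith [ht1.1, hh.1], by linarith [ht.2, hh.2]⟩
    have h3 := hy t (Ioo_subset_Icc_self ht1) (t + h) (Ioo_subset_Icc_self ht2)
    rw [← h1 ht1, ← h2 ht2, ← toVDual_sub] at h3
    simp only [D, W, N, ← h3]
    rw [smul_apply, toVDual_apply, map_add, inner_sub_left, inner_add_right, inner_add_right,
      real_inner_self_eq_norm_sq, real_inner_self_eq_norm_sq, real_inner_comm (ι (f t))]
    congr 1
    ring
  have := tendsto_nhds_unique (lim1.congr' (hEq.mono fun _ h => h.symm)) lim2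
  change N b - N a = _
  rw [← this, intervalIntegral.integral_of_le hab, ← integral_Icc_eq_integral_Ioc]
  simp only [map_smul, smul_eq_mul, ν]
  rw [integral_const_mul]

/-- A square integrable function has points near `t` with `|s - t| ‖f s‖²` small. -/
theorem exists_small_mul_normSq {E : Type*} [NormedAddCommGroup E] {f : ℝ → E}
    (hf : MemLp f 2 volume) {T : ℝ} (hT : 0 < T) {G : Set ℝ} (hG : ∀ᵐ t, t ∈ Ioo 0 T → t ∈ G)
    {t : ℝ} (ht : t ∈ Icc 0 T) {ε : ℝ} (hε : 0 < ε) :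
    ∃ s ∈ G, |s - t| < ε ∧ |s - t| * ‖f s‖ ^ 2 < ε := by
  by_contra! hcon
  let a := max 0 (t - ε)
  let b := min T (t + ε)
  have hab : a < b := by
    simp only [a, b, max_lt_iff, lt_min_iff]
    refine ⟨⟨hT, ?_⟩, ?_, ?_⟩ <;> linarith [ht.1, ht.2]
  have htab : t ∈ uIcc a b := by
    rw [uIcc_of_le hab.le]
    simp only [a, b, mem_Icc, max_le_iff, le_min_iff]
    refine ⟨⟨ht.1, ?_⟩, ht.2, ?_⟩ <;> linarith
  have hnot : ¬ IntervalIntegrable (fun x => (x - t)⁻¹) volume a b := by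
    rw [intervalIntegrable_sub_inv_iff]
    push Not
    exact ⟨hab.ne, htab⟩
  refine hnot ?_
  have hi : IntervalIntegrable (fun s => ε⁻¹ * ‖f s‖ ^ 2) volume a b :=
    (hf.norm.integrable_sq.const_mul _).intervalIntegrable
  refine hi.mono_fun' (by fun_prop) ?_
  have hne : ∀ c : ℝ, ∀ᵐ s : ℝ, s ≠ c := fun c => by simp [ae_iff]
  filter_upwards [ae_restrict_of_ae hG, ae_restrict_mem measurableSet_uIoc,
    ae_restrict_of_ae (hne b), ae_restrict_of_ae (hne t)] with s h1 h2 h3 h4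
  rw [uIoc_of_le hab.le] at h2
  have h5 : s < b := lt_of_le_of_ne h2.2 h3
  have h6 := h2.1
  simp only [a, b, max_lt_iff, lt_min_iff] at h5 h6
  have h7 := hcon s (h1 ⟨h6.1, h5.1⟩) (abs_lt.2 ⟨by linarith, by linarith⟩)
  have h8 : 0 < |s - t| := abs_pos.2 (sub_ne_zero.2 h4)
  rw [norm_inv, Real.norm_eq_abs, inv_mul_eq_div, inv_le_iff_one_le_mul₀ h8, div_mul_eq_mul_div,
    le_div_iff₀ hε, one_mul, mul_comm]
  exact h7

theorem norm_intervalIntegral_le_sqrt {E : Type*} [NormedAddCommGroup E] [NormedSpace ℝ E]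
    {g : ℝ → E} (hg : MemLp g 2 volume) (s t : ℝ) :
    ‖∫ r in s..t, g r‖ ≤ √|t - s| * (eLpNorm g 2 volume).toReal := by
  have h1 : ‖∫ r in s..t, g r‖ ≤ ∫ r in uIoc s t, ‖g r‖ :=
    intervalIntegral.norm_integral_le_integral_norm_uIoc
  let k := hg.norm.toLp
  have h2 := L2.inner_indicatorConstLp_eq_inner_setIntegral ℝ (μ := volume) (s := uIoc s t)
    (hs := measurableSet_uIoc) (by simp) (1 : ℝ) k
  have h3 : ∫ r in uIoc s t, ‖g r‖ = ∫ r in uIoc s t, k r :=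
    integral_congr_ae (ae_restrict_of_ae (hg.norm.coeFn_toLp.mono fun _ h => h.symm))
  have h4 : ‖k‖ = (eLpNorm g 2 volume).toReal := by
    rw [Lp.norm_toLp, eLpNorm_norm]
  rw [h3.trans (by simpa using h2.symm)] at h1
  refine h1.trans ((real_inner_le_norm _ _).trans ?_)
  rw [h4]
  gcongr
  rw [norm_indicatorConstLp (by simp) (by simp)]
  simp [Measure.real, Real.volume_uIoc, Real.sqrt_eq_rpow]

theorem exists_limit_of_energy [CompleteSpace H] (ι : V →L[ℝ] H) {T : ℝ} {f : ℝ → V}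
    {y : ℝ → StrongDual ℝ V} {e : ℝ → ℝ} {G : Set ℝ} (hGT : G ⊆ Icc 0 T)
    (hyf : ∀ s ∈ G, toVDual ι (ι (f s)) = y s) (hef : ∀ s ∈ G, ‖ι (f s)‖ ^ 2 = e s)
    {C : ℝ} (hy : ∀ s ∈ Icc 0 T, ∀ t ∈ Icc 0 T, ‖y t - y s‖ ≤ √|t - s| * C)
    (he : ContinuousOn e (Icc 0 T)) {t : ℝ} (ht : t ∈ Icc 0 T)
    (hG : ∀ ε > 0, ∃ s ∈ G, |s - t| < ε ∧ |s - t| * ‖f s‖ ^ 2 < ε) :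
    ∃ U : H, toVDual ι U = y t ∧ ‖U‖ ^ 2 = e t := by
  choose s hsG hs1 hs2 using fun n : ℕ => hG (1 / ((n : ℝ) + 1)) Nat.one_div_pos_of_nat
  have hz : Tendsto (fun n : ℕ => 1 / ((n : ℝ) + 1)) atTop (𝓝 0) :=
    tendsto_one_div_add_atTop_nhds_zero_nat
  have hst : Tendsto s atTop (𝓝 t) := by
    rw [tendsto_iff_dist_tendsto_zero]
    exact squeeze_zero (fun _ => dist_nonneg) (fun n => (hs1 n).le) hz
  have hes : Tendsto (fun n => e (s n)) atTop (𝓝 (e t)) :=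
    (he t ht).tendsto.comp
      (tendsto_nhdsWithin_iff.2 ⟨hst, Eventually.of_forall fun n => hGT (hsG n)⟩)
  let δ : ℕ → ℝ := fun n => √2 * |C| * √(|s n - t| * ‖f (s n)‖ ^ 2)
  have hδ0 : ∀ n, 0 ≤ δ n := fun n => by positivity
  have hδ : Tendsto δ atTop (𝓝 0) := by
    have h1 : Tendsto (fun n => |s n - t| * ‖f (s n)‖ ^ 2) atTop (𝓝 0) :=
      squeeze_zero (fun _ => by positivity) (fun n => (hs2 n).le) hz
    simpa [δ] using (h1.sqrt.const_mul (√2 * |C|))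
  have hwlog : ∀ n m, |s n - t| ≤ |s m - t| →
      ‖ι (f (s n)) - ι (f (s m))‖ ^ 2 ≤ |e (s n) - e (s m)| + 2 * δ m := by
    intro n m hnm
    have h1 : ‖ι (f (s n)) - ι (f (s m))‖ ^ 2 =
        e (s n) - e (s m) - 2 * (y (s n) - y (s m)) (f (s m)) := by
      rw [← hyf _ (hsG n), ← hyf _ (hsG m), ← toVDual_sub, toVDual_apply, inner_sub_left,
        real_inner_self_eq_norm_sq, ← hef _ (hsG n), ← hef _ (hsG m), norm_sub_sq_real]
      ring
    have h2 : |(y (s n) - y (s m)) (f (s m))| ≤ δ m := by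
      calc |(y (s n) - y (s m)) (f (s m))| ≤ ‖y (s n) - y (s m)‖ * ‖f (s m)‖ :=
            (y (s n) - y (s m)).le_opNorm _
        _ ≤ (√|s n - s m| * |C|) * ‖f (s m)‖ := by
            gcongr
            refine (hy _ (hGT (hsG m)) _ (hGT (hsG n))).trans ?_
            gcongr
            exact le_abs_self C
        _ ≤ (√(2 * |s m - t|) * |C|) * ‖f (s m)‖ := by
            gcongr
            have := abs_sub_le (s n) t (s m)
            rw [abs_sub_comm t (s m)] at this
            linarith
        _ = δ m := by
            simp only [δ]
            rw [Real.sqrt_mul (by norm_num), Real.sqrt_mul (abs_nonneg _),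
              Real.sqrt_sq (norm_nonneg _)]
            ring
    rw [h1]
    have h3 := le_abs_self (e (s n) - e (s m))
    have h4 := neg_abs_le ((y (s n) - y (s m)) (f (s m)))
    linarith
  have hall : ∀ n m, ‖ι (f (s n)) - ι (f (s m))‖ ^ 2 ≤
      |e (s n) - e (s m)| + 2 * (δ n + δ m) := by
    intro n m
    rcases le_total |s n - t| |s m - t| with h | h
    · linarith [hwlog n m h, hδ0 n]
    · have := hwlog m n h
      rw [norm_sub_rev, abs_sub_comm] at this
      linarith [hδ0 m]
  have hcau : CauchySeq fun n => ι (f (s n)) := by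
    rw [Metric.cauchySeq_iff]
    intro ε hε
    obtain ⟨N₁, hN₁⟩ := Metric.cauchySeq_iff.1 hes.cauchySeq (ε ^ 2 / 2) (by positivity)
    obtain ⟨N₂, hN₂⟩ := eventually_atTop.1 (hδ.eventually (gt_mem_nhds
      (show (0 : ℝ) < ε ^ 2 / 8 by positivity)))
    refine ⟨max N₁ N₂, fun m hm n hn => ?_⟩
    rw [dist_eq_norm]
    have h1 := hall m n
    have h2 := hN₁ m (le_of_max_le_left hm) n (le_of_max_le_left hn)
    rw [Real.dist_eq] at h2
    have h3 := hN₂ m (le_of_max_le_right hm)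
    have h4 := hN₂ n (le_of_max_le_right hn)
    refine lt_of_pow_lt_pow_left₀ 2 hε.le ?_
    linarith
  obtain ⟨U, hU⟩ := cauchySeq_tendsto_of_complete hcau
  refine ⟨U, ?_, ?_⟩
  · ext v
    have h1 : Tendsto (fun n => ⟪ι (f (s n)), ι v⟫_ℝ) atTop (𝓝 ⟪U, ι v⟫_ℝ) :=
      hU.inner tendsto_const_nhds
    have h2 : Tendsto (fun n => y (s n)) atTop (𝓝 (y t)) := by
      rw [tendsto_iff_norm_sub_tendsto_zero]
      refine squeeze_zero (fun _ => norm_nonneg _)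
        (fun n => hy t ht _ (hGT (hsG n))) ?_
      have h3 : Tendsto (fun n => √|s n - t| * C) atTop (𝓝 (√|t - t| * C)) :=
        ((hst.sub_const t).abs.sqrt).mul_const C
      simpa using h3
    have h3 : Tendsto (fun n => y (s n) v) atTop (𝓝 (y t v)) :=
      tendsto_dual_apply h2 tendsto_const_nhds
    refine tendsto_nhds_unique h1 (h3.congr fun n => ?_)
    rw [← hyf _ (hsG n), toVDual_apply]
  · refine tendsto_nhds_unique (hU.norm.pow 2) (hes.congr fun n => ?_)
    rw [hef _ (hsG n)]

/-- Weak continuity together with continuity of the norm implies continuity. -/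
theorem continuous_of_continuous_toVDual {X : Type*} [TopologicalSpace X] {ι : V →L[ℝ] H}
    (hι : DenseRange ι) {U : X → H} (h1 : Continuous fun x => toVDual ι (U x))
    (h2 : Continuous fun x => ‖U x‖ ^ 2) : Continuous U := by
  refine continuous_iff_continuousAt.2 fun x => ?_
  have hn : Tendsto (fun z => ‖U z‖) (𝓝 x) (𝓝 ‖U x‖) := by
    have := (h2.sqrt).tendsto x
    simpa [Real.sqrt_sq (norm_nonneg _)] using this
  have hw : Tendsto (fun z => ⟪U z, U x⟫_ℝ) (𝓝 x) (𝓝 ⟪U x, U x⟫_ℝ) := by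
    rw [Metric.tendsto_nhds]
    intro ε hε
    obtain ⟨v, hv⟩ := hι.exists_dist_lt (U x)
      (ε := ε / (2 * (2 * ‖U x‖ + 1))) (by positivity)
    have h3 : Tendsto (fun z => ⟪U z, ι v⟫_ℝ) (𝓝 x) (𝓝 ⟪U x, ι v⟫_ℝ) :=
      tendsto_dual_apply (h1.tendsto x) tendsto_const_nhds
    filter_upwards [(Metric.tendsto_nhds.1 h3) (ε / 2) (by positivity),
      hn.eventually (gt_mem_nhds (lt_add_one ‖U x‖))] with z hz1 hz2
    rw [Real.dist_eq] at hz1 ⊢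
    have e1 : ⟪U z, U x⟫_ℝ - ⟪U x, U x⟫_ℝ =
        (⟪U z, ι v⟫_ℝ - ⟪U x, ι v⟫_ℝ) + ⟪U z - U x, U x - ι v⟫_ℝ := by
      simp only [inner_sub_left, inner_sub_right]
      ring
    have e2 : |⟪U z - U x, U x - ι v⟫_ℝ| ≤ ε / 2 := by
      refine (abs_real_inner_le_norm _ _).trans ?_
      rw [dist_eq_norm] at hv
      have e3 : ‖U z - U x‖ ≤ 2 * ‖U x‖ + 1 := (norm_sub_le _ _).trans (by linarith)
      calc ‖U z - U x‖ * ‖U x - ι v‖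
          ≤ (2 * ‖U x‖ + 1) * (ε / (2 * (2 * ‖U x‖ + 1))) := by gcongr
        _ = ε / 2 := by field_simp
    rw [e1]
    refine (abs_add_le _ _).trans_lt ?_
    linarith
  rw [ContinuousAt, tendsto_iff_norm_sub_tendsto_zero]
  have h4 : Tendsto (fun z => ‖U z - U x‖ ^ 2) (𝓝 x) (𝓝 0) := by
    have := ((hn.pow 2).sub (hw.const_mul 2)).add_const (‖U x‖ ^ 2)
    rw [real_inner_self_eq_norm_sq] at this
    have h0 : ‖U x‖ ^ 2 - 2 * ‖U x‖ ^ 2 + ‖U x‖ ^ 2 = 0 := by ring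
    rw [h0] at this
    exact this.congr fun z => (norm_sub_sq_real _ _).symm
  have := h4.sqrt
  simpa [Real.sqrt_sq (norm_nonneg _)] using this

end Energy

section LionsMagenes

variable {V H : Type*} [NormedAddCommGroup V] [NormedSpace ℝ V]
  [NormedAddCommGroup H] [InnerProductSpace ℝ H]

theorem IsContinuousVersion.unique {ι : V →L[ℝ] H} {T : ℝ} (hT : 0 < T) {u : L2Time T V}
    {U W : C(Icc (0 : ℝ) T, H)} (hU : IsContinuousVersion ι u U) (hW : IsContinuousVersion ι u W) :
    U = W := by
  have hc : ∀ Z : C(Icc (0 : ℝ) T, H), ContinuousOn (IccExtend hT.le Z) (Icc 0 T) :=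
    fun Z => (Z.continuous.Icc_extend').continuousOn
  have h1 : IccExtend hT.le U =ᵐ[volume.restrict (Icc 0 T)] IccExtend hT.le W := by
    filter_upwards [ae_restrict_of_ae hU, ae_restrict_of_ae hW, ae_restrict_mem measurableSet_Icc]
      with t h1 h2 ht
    rw [IccExtend_of_mem _ _ ht, IccExtend_of_mem _ _ ht, h1 ht, h2 ht]
  have h2 := Measure.eqOn_Icc_of_ae_eq volume hT.ne h1 (hc U) (hc W)
  ext t
  have := h2 t.2
  rwa [IccExtend_of_mem _ _ t.2, IccExtend_of_mem _ _ t.2] at this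

/-- The Lions–Magenes lemma: existence of a continuous version and the energy identity. -/
theorem HasWeakTimeDeriv.exists_continuousVersion [CompleteSpace H] {ι : V →L[ℝ] H}
    (hι : DenseRange ι) (hinj : Function.Injective (toVDual ι))
    {T : ℝ} (hT : 0 < T) {u : L2Time T V}
    {g : L2Time T (StrongDual ℝ V)}
    (h : HasWeakTimeDeriv T (fun t => toVDual ι (ι (u t))) g) :
    ∃ U : C(Icc (0 : ℝ) T, H), IsContinuousVersion ι u U ∧ ∀ t : Icc (0 : ℝ) T,
      ‖U t‖ ^ 2 - ‖U ⟨0, left_mem_Icc.2 hT.le⟩‖ ^ 2 =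
        2 * ∫ r in Icc 0 (t : ℝ), g r (u r) := by
  let f : ℝ → V := (Icc 0 T).indicator u
  let k : ℝ → StrongDual ℝ V := (Icc 0 T).indicator g
  have hf : MemLp f 2 volume := (memLp_indicator_iff_restrict measurableSet_Icc).2 (Lp.memLp u)
  have hk : MemLp k 2 volume := (memLp_indicator_iff_restrict measurableSet_Icc).2 (Lp.memLp g)
  have hkm : StronglyMeasurable k := (Lp.stronglyMeasurable g).indicator measurableSet_Icc
  have hfu : ∀ t ∈ Icc 0 T, f t = u t := fun t ht => indicator_of_mem ht _
  have hkg : ∀ t ∈ Icc 0 T, k t = g t := fun t ht => indicator_of_mem ht _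
  have hki : ∀ x z, IntervalIntegrable k volume x z := fun x z =>
    ((hk.locallyIntegrable (by norm_num)).integrableOn_isCompact isCompact_uIcc).intervalIntegrable
  obtain ⟨c, hc⟩ := h.exists_eq_primitive hT
  let y : ℝ → StrongDual ℝ V := fun t => c + ∫ r in (0 : ℝ)..t, k r
  have hy : ∀ s ∈ Icc 0 T, ∀ t ∈ Icc 0 T, y t - y s = ∫ r in s..t, k r := by
    intro s _ t _
    simp only [y, add_sub_add_left_eq_sub]
    exact intervalIntegral.integral_interval_sub_left (hki _ _) (hki _ _)
  have hyf : ∀ᵐ t, t ∈ Ioo 0 T → toVDual ι (ι (f t)) = y t := by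
    filter_upwards [hc] with t ht htm
    rw [hfu t (Ioo_subset_Icc_self htm), ht htm]
    simp only [y]
    congr 1
    refine intervalIntegral.integral_congr fun r hr => (hkg r ?_).symm
    rw [uIcc_of_le htm.1.le] at hr
    exact ⟨hr.1, hr.2.trans htm.2.le⟩
  let N : ℝ → ℝ := fun t => ‖ι (f t)‖ ^ 2
  have hN : LocallyIntegrable N volume := by
    have : MemLp (fun t => ‖ι (f t)‖) 2 volume := (ι.comp_memLp' hf).norm
    exact this.integrable_sq.locallyIntegrable
  let G : Set ℝ := {t | t ∈ Ioo 0 T ∧ toVDual ι (ι (f t)) = y t ∧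
    HasDerivAt (fun x => ∫ r in (0 : ℝ)..x, N r) (N t) t}
  have hG : ∀ᵐ t, t ∈ Ioo 0 T → t ∈ G := by
    filter_upwards [hyf, LocallyIntegrable.ae_hasDerivAt_integral hN] with t h1 h2 ht
    exact ⟨ht, h1 ht, h2 0⟩
  have hGT : G ⊆ Icc 0 T := fun t ht => Ioo_subset_Icc_self ht.1
  have hen : ∀ s ∈ G, ∀ t ∈ G, N t - N s = 2 * ∫ r in s..t, k r (f r) := by
    intro s hs t ht
    rcases le_total s t with hst | hst
    · exact normSq_sub_normSq_eq ι hf hkm hk hy hyf hs.1 ht.1 hst hs.2.2 ht.2.2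
    · have := normSq_sub_normSq_eq ι hf hkm hk hy hyf ht.1 hs.1 hst ht.2.2 hs.2.2
      rw [intervalIntegral.integral_symm]
      change N s - N t = _ at this
      linarith
  have hkf : Integrable (fun r => k r (f r)) := integrable_dual_apply hk hf
  have hkfi : ∀ x z, IntervalIntegrable (fun r => k r (f r)) volume x z := fun x z =>
    hkf.intervalIntegrable
  obtain ⟨s₀, hs₀, -⟩ := exists_small_mul_normSq hf hT hG (left_mem_Icc.2 hT.le) one_pos
  let e : ℝ → ℝ := fun t => N s₀ + 2 * ∫ r in s₀..t, k r (f r)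
  have hec : Continuous e :=
    continuous_const.add ((intervalIntegral.continuous_primitive hkfi s₀).const_mul 2)
  have hef : ∀ s ∈ G, ‖ι (f s)‖ ^ 2 = e s := fun s hs => by
    have := hen s₀ hs₀ s hs
    change N s = _
    simp only [e]
    linarith
  have hlim : ∀ t : Icc (0 : ℝ) T, ∃ U : H, toVDual ι U = y t ∧ ‖U‖ ^ 2 = e t := fun t =>
    exists_limit_of_energy ι hGT (fun s hs => hs.2.1) hef
      (fun s hs t ht => by rw [hy s hs t ht]; exact norm_intervalIntegral_le_sqrt hk s t)
      hec.continuousOn t.2 fun ε hε => exists_small_mul_normSq hf hT hG t.2 hε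
  choose U hU1 hU2 using hlim
  have hyc : Continuous y := continuous_const.add (intervalIntegral.continuous_primitive hki 0)
  have hUc : Continuous U := by
    refine continuous_of_continuous_toVDual hι ?_ ?_
    · simp only [hU1]
      exact hyc.comp continuous_subtype_val
    · simp only [hU2]
      exact hec.comp continuous_subtype_val
  refine ⟨⟨U, hUc⟩, ?_, fun t => ?_⟩
  · have hne : ∀ c : ℝ, ∀ᵐ s : ℝ, s ≠ c := fun c => by simp [ae_iff]
    filter_upwards [hyf, hne 0, hne T] with t h1 h2 h3 ht
    have ht' : t ∈ Ioo 0 T := ⟨lt_of_le_of_ne ht.1 h2.symm, lt_of_le_of_ne ht.2 h3⟩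
    refine hinj ?_
    rw [← hfu t ht, h1 ht']
    exact hU1 ⟨t, ht⟩
  · simp only [ContinuousMap.coe_mk, hU2, e]
    have h1 : ∫ r in Icc 0 (t : ℝ), g r (u r) = ∫ r in (0 : ℝ)..t, k r (f r) := by
      rw [intervalIntegral.integral_of_le t.2.1, ← integral_Icc_eq_integral_Ioc]
      refine setIntegral_congr_fun measurableSet_Icc fun r hr => ?_
      have hr' : r ∈ Icc 0 T := ⟨hr.1, hr.2.trans t.2.2⟩
      simp only [hfu r hr', hkg r hr']
    rw [h1, ← intervalIntegral.integral_add_adjacent_intervals (hkfi s₀ 0) (hkfi 0 t)]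
    ring

theorem toVDual_injective {ι : V →L[ℝ] H} (hι : DenseRange ι) :
    Function.Injective (toVDual ι) := by
  intro h k hhk
  refine ext_inner_right ℝ fun x => ?_
  refine hι.induction_on (p := fun x => ⟪h, x⟫_ℝ = ⟪k, x⟫_ℝ) x ?_ fun v => ?_
  · exact isClosed_eq (by fun_prop) (by fun_prop)
  · rw [← toVDual_apply, hhk, toVDual_apply]

end LionsMagenes

section EnergySpace

variable {V H : Type*} [NormedAddCommGroup V] [NormedSpace ℝ V]
  [NormedAddCommGroup H] [InnerProductSpace ℝ H]

theorem HasWeakTimeDeriv.congr {E : Type*} [NormedAddCommGroup E] [NormedSpace ℝ E] {T : ℝ}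
    {u v u' v' : ℝ → E} (h : HasWeakTimeDeriv T u u') (hu : v =ᵐ[volume.restrict (Icc 0 T)] u)
    (hu' : v' =ᵐ[volume.restrict (Icc 0 T)] u') : HasWeakTimeDeriv T v v' := by
  obtain ⟨h1, h2, h3⟩ := h
  refine ⟨h1.congr hu.symm, h2.congr hu'.symm, fun φ hφ hc hs => ?_⟩
  have e1 : ∫ t in Icc 0 T, deriv φ t • v t = ∫ t in Icc 0 T, deriv φ t • u t :=
    integral_congr_ae (hu.mono fun t ht => by simp only [ht])
  have e2 : ∫ t in Icc 0 T, φ t • v' t = ∫ t in Icc 0 T, φ t • u' t :=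
    integral_congr_ae (hu'.mono fun t ht => by simp only [ht])
  rw [e1, e2, h3 φ hφ hc hs]

theorem HasWeakTimeDeriv.add {E : Type*} [NormedAddCommGroup E] [NormedSpace ℝ E] {T : ℝ}
    {u v u' v' : ℝ → E} (hu : HasWeakTimeDeriv T u u') (hv : HasWeakTimeDeriv T v v') :
    HasWeakTimeDeriv T (fun t => u t + v t) (fun t => u' t + v' t) := by
  obtain ⟨h1, h2, h3⟩ := hu
  obtain ⟨k1, k2, k3⟩ := hv
  refine ⟨h1.add k1, h2.add k2, fun φ hφ hc hs => ?_⟩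
  have hφ1 : ContDiff ℝ 1 φ := hφ.of_le (by exact_mod_cast le_top)
  have hd : ContinuousOn (deriv φ) (Icc 0 T) := (hφ1.continuous_deriv le_rfl).continuousOn
  have hφc : ContinuousOn φ (Icc 0 T) := hφ.continuous.continuousOn
  have i : ∀ {χ : ℝ → ℝ} {z : ℝ → E}, ContinuousOn χ (Icc 0 T) → IntegrableOn z (Icc 0 T) →
      IntegrableOn (fun t => χ t • z t) (Icc 0 T) := fun hχ hz =>
    hz.continuousOn_smul hχ isCompact_Icc
  simp only [smul_add]
  rw [integral_add (i hd h1) (i hd k1), integral_add (i hφc h2) (i hφc k2), h3 φ hφ hc hs,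
    k3 φ hφ hc hs, neg_add]

theorem HasWeakTimeDeriv.const_smul {E : Type*} [NormedAddCommGroup E] [NormedSpace ℝ E] {T : ℝ}
    {u u' : ℝ → E} (hu : HasWeakTimeDeriv T u u') (c : ℝ) :
    HasWeakTimeDeriv T (fun t => c • u t) (fun t => c • u' t) := by
  obtain ⟨h1, h2, h3⟩ := hu
  refine ⟨h1.smul c, h2.smul c, fun φ hφ hc hs => ?_⟩
  simp only [smul_comm _ c]
  rw [integral_smul, integral_smul, h3 φ hφ hc hs, smul_neg]

theorem toVDual_add (ι : V →L[ℝ] H) (h k : H) : toVDual ι (h + k) = toVDual ι h + toVDual ι k := by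
  ext v
  simp [toVDual_apply, inner_add_left]

theorem toVDual_smul (ι : V →L[ℝ] H) (c : ℝ) (h : H) : toVDual ι (c • h) = c • toVDual ι h := by
  ext v
  simp [toVDual_apply, inner_smul_left]

/-- Triples `(w, w', W)` of a function `w ∈ L²(V)`, its weak derivative `w' ∈ L²(V*)` and its
continuous version `W ∈ C(H)`. -/
def energySpace (ι : V →L[ℝ] H) (T : ℝ) :
    Submodule ℝ (L2Time T V × L2Time T (StrongDual ℝ V) × C(Icc (0 : ℝ) T, H)) where
  carrier := {w | HasWeakTimeDeriv T (fun t => toVDual ι (ι (w.1 t))) w.2.1 ∧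
    IsContinuousVersion ι w.1 w.2.2}
  zero_mem' := by
    have h0 : HasWeakTimeDeriv T (fun _ => (0 : StrongDual ℝ V)) (fun _ => 0) :=
      ⟨integrableOn_zero, integrableOn_zero, fun φ _ _ _ => by simp⟩
    refine ⟨h0.congr ?_ (Lp.coeFn_zero _ _ _), ?_⟩
    · filter_upwards [Lp.coeFn_zero V 2 (volume.restrict (Icc 0 T))] with t ht
      change (0 : L2Time T V) t = 0 at ht
      ext v
      change ⟪ι ((0 : L2Time T V) t), ι v⟫_ℝ = 0
      rw [ht, map_zero, inner_zero_left]
    · have := (ae_restrict_iff' measurableSet_Icc).1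
        (Lp.coeFn_zero V 2 (volume.restrict (Icc 0 T)))
      filter_upwards [this] with t ht htm
      change (0 : H) = ι ((0 : L2Time T V) t)
      rw [ht htm, Pi.zero_apply, map_zero]
  add_mem' := by
    rintro ⟨u, u', U⟩ ⟨w, w', W⟩ ⟨h1, h2⟩ ⟨k1, k2⟩
    refine ⟨(h1.add k1).congr ?_ (Lp.coeFn_add _ _), ?_⟩
    · filter_upwards [Lp.coeFn_add u w] with t ht
      simp only [Prod.mk_add_mk, ht, Pi.add_apply, map_add, toVDual_add]
    · have := (ae_restrict_iff' measurableSet_Icc).1 (Lp.coeFn_add u w)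
      filter_upwards [this, h2, k2] with t ht e1 e2 htm
      simp only [Prod.mk_add_mk, ht htm, Pi.add_apply, map_add, ContinuousMap.add_apply,
        e1 htm, e2 htm]
  smul_mem' := by
    rintro c ⟨u, u', U⟩ ⟨h1, h2⟩
    refine ⟨(h1.const_smul c).congr ?_ (Lp.coeFn_smul _ _), ?_⟩
    · filter_upwards [Lp.coeFn_smul c u] with t ht
      simp only [Prod.smul_mk, ht, Pi.smul_apply, map_smul, toVDual_smul]
    · have := (ae_restrict_iff' measurableSet_Icc).1 (Lp.coeFn_smul c u)
      filter_upwards [this, h2] with t ht e1 htm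
      simp only [Prod.smul_mk, ht htm, Pi.smul_apply, map_smul, ContinuousMap.smul_apply, e1 htm]

variable {T : ℝ}

theorem memLp_continuous_smul {E : Type*} [NormedAddCommGroup E] [NormedSpace ℝ E] {φ : ℝ → ℝ}
    (hφ : Continuous φ) (x : E) (T : ℝ) :
    MemLp (fun t => φ t • x) 2 (volume.restrict (Icc 0 T)) := by
  have hc : Continuous fun t => φ t • x := hφ.smul continuous_const
  obtain ⟨C, hC⟩ := isCompact_Icc.exists_bound_of_continuousOn (s := Icc 0 T) hc.continuousOn
  exact MemLp.of_bound hc.aestronglyMeasurable C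
    ((ae_restrict_mem measurableSet_Icc).mono hC)

theorem hasWeakTimeDeriv_smul_const {E : Type*} [NormedAddCommGroup E] [NormedSpace ℝ E]
    [CompleteSpace E] {φ : ℝ → ℝ} (hφ : ContDiff ℝ ∞ φ) (x : E) (hT : 0 < T) :
    HasWeakTimeDeriv T (fun t => φ t • x) (fun t => deriv φ t • x) := by
  have hφ1 : ContDiff ℝ 1 φ := hφ.of_le (by exact_mod_cast le_top)
  have hφ' : Continuous (deriv φ) := hφ1.continuous_deriv le_rfl
  refine ⟨(hφ.continuous.smul continuous_const).continuousOn.integrableOn_Icc,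
    (hφ'.smul continuous_const).continuousOn.integrableOn_Icc, fun χ hχ hc hs => ?_⟩
  have hχ1 : ContDiff ℝ 1 χ := hχ.of_le (by exact_mod_cast le_top)
  have hχ' : Continuous (deriv χ) := hχ1.continuous_deriv le_rfl
  simp only [smul_smul]
  rw [integral_smul_const, integral_smul_const, ← neg_smul]
  congr 1
  have h0 : χ 0 = 0 := image_eq_zero_of_notMem_tsupport fun h => lt_irrefl _ (hs h).1
  have hT0 : χ T = 0 := image_eq_zero_of_notMem_tsupport fun h => lt_irrefl _ (hs h).2
  rw [integral_Icc_eq_integral_Ioc, integral_Icc_eq_integral_Ioc,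
    ← intervalIntegral.integral_of_le hT.le, ← intervalIntegral.integral_of_le hT.le,
    intervalIntegral.integral_mul_deriv_eq_deriv_mul (u := χ) (v := φ) (u' := deriv χ)
      (fun t _ => (hχ1.differentiable (by norm_num) t).hasDerivAt)
      (fun t _ => (hφ1.differentiable (by norm_num) t).hasDerivAt)
      (hχ'.intervalIntegrable _ _) (hφ'.intervalIntegrable _ _), h0, hT0]
  ring

theorem smul_const_mem_energySpace (ι : V →L[ℝ] H) (hT : 0 < T) {φ : ℝ → ℝ} (hφ : ContDiff ℝ ∞ φ)
    (hφ' : Continuous (deriv φ)) (x : V) :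
    (((memLp_continuous_smul hφ.continuous x T).toLp,
      (memLp_continuous_smul hφ' (toVDual ι (ι x)) T).toLp,
      ⟨fun t => φ t • ι x, (hφ.continuous.comp continuous_subtype_val).smul continuous_const⟩) :
      L2Time T V × L2Time T (StrongDual ℝ V) × C(Icc (0 : ℝ) T, H)) ∈ energySpace ι T := by
  constructor
  · refine (hasWeakTimeDeriv_smul_const hφ (toVDual ι (ι x)) hT).congr ?_
      (memLp_continuous_smul hφ' (toVDual ι (ι x)) T).coeFn_toLp
    filter_upwards [(memLp_continuous_smul hφ.continuous x T).coeFn_toLp] with t ht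
    rw [ht, map_smul, toVDual_smul]
  · have := (ae_restrict_iff' measurableSet_Icc).1
      (memLp_continuous_smul hφ.continuous x T).coeFn_toLp
    filter_upwards [this] with t ht htm
    simp only [ht htm, map_smul, ContinuousMap.coe_mk]

/-- Smooth profiles with value `1` at `0`, value `0` at `T` and small `L²` norm. -/
theorem exists_profile (hT : 0 < T) {ε : ℝ} (hε : 0 < ε) :
    ∃ φ : ℝ → ℝ, ContDiff ℝ ∞ φ ∧ φ 0 = 1 ∧ φ T = 0 ∧ ∫ t in Icc 0 T, φ t ^ 2 ≤ ε := by
  obtain ⟨n, hn⟩ := exists_nat_gt (T / ε)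
  refine ⟨fun t => (1 - t / T) ^ (n + 1), by fun_prop, by simp, by simp [hT.ne'], ?_⟩
  have h1 : ∀ t, HasDerivAt (fun t : ℝ => -(T / (2 * n + 3)) * (1 - t / T) ^ (2 * n + 3))
      (((1 - t / T) ^ (n + 1)) ^ 2) t := by
    intro t
    have h2 : HasDerivAt (fun t : ℝ => 1 - t / T) (-(1 / T)) t := by
      simpa using ((hasDerivAt_id t).div_const T).const_sub 1
    refine ((h2.pow (2 * n + 3)).const_mul (-(T / (2 * n + 3)))).congr_deriv ?_
    have : (2 * (n : ℝ) + 3) ≠ 0 := by positivity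
    rw [show 2 * n + 3 - 1 = (n + 1) * 2 by omega, pow_mul]
    push_cast
    field_simp
  rw [integral_Icc_eq_integral_Ioc, ← intervalIntegral.integral_of_le hT.le,
    intervalIntegral.integral_eq_sub_of_hasDerivAt (fun t _ => h1 t)
      ((by fun_prop : Continuous fun t : ℝ => ((1 - t / T) ^ (n + 1)) ^ 2).intervalIntegrable _ _)]
  rw [div_self hT.ne', sub_self, zero_pow (by omega), zero_div, sub_zero, one_pow]
  rw [div_lt_iff₀ hε] at hn
  have h3 : T / (2 * n + 3) ≤ ε := by
    rw [div_le_iff₀ (by positivity)]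
    nlinarith [Nat.cast_nonneg (α := ℝ) n]
  linarith

theorem norm_smul_const_toLp_le {φ : ℝ → ℝ} (hφ : Continuous φ) (x : V) (T : ℝ) :
    ‖(memLp_continuous_smul hφ x T).toLp‖ ≤ √(∫ t in Icc 0 T, φ t ^ 2) * ‖x‖ := by
  let k := (memLp_continuous_smul hφ (1 : ℝ) T).toLp
  have h1 : ‖k‖ = √(∫ t in Icc 0 T, φ t ^ 2) := by
    rw [eq_comm, Real.sqrt_eq_iff_eq_sq (integral_nonneg fun t => sq_nonneg _) (norm_nonneg _),
      ← real_inner_self_eq_norm_sq, L2.inner_def]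
    refine integral_congr_ae ?_
    filter_upwards [(memLp_continuous_smul hφ (1 : ℝ) T).coeFn_toLp] with t ht
    simp only [k, ht]
    simp [sq]
  rw [← h1, mul_comm]
  refine Lp.norm_le_mul_norm_of_ae_le_mul ?_
  filter_upwards [(memLp_continuous_smul hφ (1 : ℝ) T).coeFn_toLp,
    (memLp_continuous_smul hφ x T).coeFn_toLp] with t h2 h3
  rw [h3, h2, norm_smul, mul_comm, smul_eq_mul, mul_one]

variable [CompleteSpace H] {ι : V →L[ℝ] H}

theorem energySpace_normSq (hι : DenseRange ι) (hT : 0 < T)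
    {w : L2Time T V × L2Time T (StrongDual ℝ V) × C(Icc (0 : ℝ) T, H)}
    (hw : w ∈ energySpace ι T) (t : Icc (0 : ℝ) T) :
    ‖w.2.2 t‖ ^ 2 - ‖w.2.2 ⟨0, left_mem_Icc.2 hT.le⟩‖ ^ 2 =
      2 * ∫ r in Icc 0 (t : ℝ), w.2.1 r (w.1 r) := by
  obtain ⟨U, hU, hUe⟩ := hw.1.exists_continuousVersion hι (toVDual_injective hι) hT
  rw [hw.2.unique hT hU]
  exact hUe t

theorem lpDualPairing_self (hι : DenseRange ι) (hT : 0 < T)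
    {w : L2Time T V × L2Time T (StrongDual ℝ V) × C(Icc (0 : ℝ) T, H)}
    (hw : w ∈ energySpace ι T) :
    2 * lpDualPairing _ V w.2.1 w.1 = ‖w.2.2 ⟨T, right_mem_Icc.2 hT.le⟩‖ ^ 2 -
      ‖w.2.2 ⟨0, left_mem_Icc.2 hT.le⟩‖ ^ 2 := by
  rw [energySpace_normSq hι hT hw, lpDualPairing_apply]

theorem lpDualPairing_add_swap (hι : DenseRange ι) (hT : 0 < T)
    {w z : L2Time T V × L2Time T (StrongDual ℝ V) × C(Icc (0 : ℝ) T, H)}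
    (hw : w ∈ energySpace ι T) (hz : z ∈ energySpace ι T) :
    lpDualPairing _ V w.2.1 z.1 + lpDualPairing _ V z.2.1 w.1 =
      ⟪w.2.2 ⟨T, right_mem_Icc.2 hT.le⟩, z.2.2 ⟨T, right_mem_Icc.2 hT.le⟩⟫_ℝ -
      ⟪w.2.2 ⟨0, left_mem_Icc.2 hT.le⟩, z.2.2 ⟨0, left_mem_Icc.2 hT.le⟩⟫_ℝ := by
  have h1 := lpDualPairing_self hι hT hw
  have h2 := lpDualPairing_self hι hT hz
  have h3 := lpDualPairing_self hι hT (add_mem hw hz)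
  simp only [Prod.snd_add, Prod.fst_add, map_add, add_apply, ContinuousMap.add_apply,
    norm_add_sq_real] at h3
  linarith

end EnergySpace

section Superposition

variable {V : Type*} [NormedAddCommGroup V] [NormedSpace ℝ V]

/-- Monotone hemicontinuous operators of linear growth are demicontinuous. -/
theorem IsMonotoneOp.continuous_apply {A : V → StrongDual ℝ V} (hA2 : IsMonotoneOp A)
    (hA3 : HasLinearGrowth A) (hA4 : IsHemicontinuous A) (v : V) :
    Continuous fun u => A u v := by
  obtain ⟨c, hc, hA3⟩ := hA3
  refine continuous_iff_continuousAt.2 fun u => Metric.tendsto_nhds.2 fun ε hε => ?_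
  have h0 : Tendsto (fun θ : ℝ => A (u + θ • v) v) (𝓝[>] 0) (𝓝 (A u v)) := by
    have := ((hA4 u v v).tendsto 0).mono_left (nhdsWithin_le_nhds (s := Ioi 0))
    simpa using this
  have h0' : Tendsto (fun θ : ℝ => A (u + θ • -v) v) (𝓝[>] 0) (𝓝 (A u v)) := by
    have := ((hA4 u v (-v)).tendsto 0).mono_left (nhdsWithin_le_nhds (s := Ioi 0))
    simpa using this
  obtain ⟨θ, ⟨hθ1, hθ2⟩, hθ⟩ := (((Metric.tendsto_nhds.1 h0 (ε / 2) (by positivity)).and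
    (Metric.tendsto_nhds.1 h0' (ε / 2) (by positivity))).and self_mem_nhdsWithin).exists
  have hθ : 0 < θ := hθ
  let K : ℝ := c * (1 + (‖u‖ + 1)) + c * (1 + (‖u‖ + θ * ‖v‖))
  have hK : 0 < K := by positivity
  have hest : ∀ z : V, ‖z‖ = ‖v‖ → ∀ u', ‖u' - u‖ < 1 →
      -(K * ‖u' - u‖) ≤ θ * (A u' - A (u + θ • z)) z := by
    intro z hz u' hu'
    have h1 := hA2 u' (u + θ • z)
    have h2 : u' - (u + θ • z) = (u' - u) - θ • z := by abel
    rw [h2, map_sub, map_smul, smul_eq_mul] at h1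
    have h3 : ‖A u' - A (u + θ • z)‖ ≤ K := by
      refine (norm_sub_le _ _).trans (add_le_add ((hA3 _).trans ?_) ((hA3 _).trans ?_))
      · gcongr
        have := norm_add_le (u' - u) u
        rw [sub_add_cancel] at this
        linarith
      · gcongr
        refine (norm_add_le _ _).trans ?_
        rw [norm_smul, hz, Real.norm_of_nonneg hθ.le]
    have h4 : |(A u' - A (u + θ • z)) (u' - u)| ≤ K * ‖u' - u‖ :=
      ((A u' - A (u + θ • z)).le_opNorm _).trans (by gcongr)
    linarith [(abs_le.1 h4).1]
  filter_upwards [Metric.ball_mem_nhds u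
    (show 0 < min 1 (θ * ε / (2 * K)) by positivity)] with u' hu'
  rw [Metric.mem_ball, dist_eq_norm, lt_min_iff] at hu'
  have h1 := hest v rfl u' hu'.1
  have h2 := hest (-v) (norm_neg v) u' hu'.1
  have h3 : K * ‖u' - u‖ < θ * (ε / 2) := by
    have := hu'.2
    rw [lt_div_iff₀ (by positivity)] at this
    linarith
  simp only [Real.dist_eq, sub_apply, map_neg] at *
  rw [abs_lt] at *
  have h4 : -(ε / 2) < A u' v - A (u + θ • v) v := by nlinarith
  have h5 : A u' v - A (u + θ • -v) v < ε / 2 := by nlinarith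
  constructor <;> linarith [hθ1.1, hθ1.2, hθ2.1, hθ2.2]

theorem norm_Lp_sq_eq {Ω E : Type*} [MeasurableSpace Ω] {μ : Measure Ω} [NormedAddCommGroup E]
    (u : Lp E 2 μ) : ‖u‖ ^ 2 = ∫ t, ‖u t‖ ^ 2 ∂μ := by
  let k := (Lp.memLp u).norm.toLp
  have h1 : ‖k‖ = ‖u‖ := by
    rw [Lp.norm_toLp, eLpNorm_norm, Lp.norm_def]
  rw [← h1, ← real_inner_self_eq_norm_sq, L2.inner_def]
  refine integral_congr_ae ?_
  filter_upwards [(Lp.memLp u).norm.coeFn_toLp] with t ht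
  simp only [k, ht]
  simp [sq]

variable {T : ℝ}

/-- The superposition operator `u ↦ A(u(·))` on `L²([0,T]; V)`. -/
theorem exists_superposition [TopologicalSpace.SeparableSpace (StrongDual ℝ V)]
    {A : V → StrongDual ℝ V} (hA2 : IsMonotoneOp A) (hA3 : HasLinearGrowth A)
    (hA4 : IsHemicontinuous A) (T : ℝ) :
    ∃ S : L2Time T V → L2Time T (StrongDual ℝ V),
      (∀ u, ∀ᵐ t ∂(volume : Measure ℝ).restrict (Icc 0 T), S u t = A (u t)) ∧
      ∃ C, 0 ≤ C ∧ ∀ u, ‖S u‖ ≤ C * (1 + ‖u‖) := by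
  have hcont := hA2.continuous_apply hA3 hA4
  obtain ⟨c, hc, hA3⟩ := hA3
  let μ : Measure ℝ := volume.restrict (Icc 0 T)
  have hone : MemLp (fun _ : ℝ => (1 : ℝ)) 2 μ := memLp_const 1
  have hbd : ∀ u : L2Time T V, MemLp (fun t => 1 + ‖u t‖) 2 μ := fun u =>
    hone.add (Lp.memLp u).norm
  have hmem : ∀ u : L2Time T V, MemLp (fun t => A (u t)) 2 μ := by
    intro u
    refine (hbd u).of_le_mul (c := c) ?_ ?_
    · refine (stronglyMeasurable_dual_of_apply fun v => ?_).aestronglyMeasurable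
      exact ((hcont v).comp_stronglyMeasurable (Lp.stronglyMeasurable u)).measurable
    · filter_upwards with t
      rw [Real.norm_of_nonneg (by positivity)]
      exact hA3 _
  refine ⟨fun u => (hmem u).toLp, fun u => (hmem u).coeFn_toLp, c * (‖hone.toLp‖ + 1),
    by positivity, fun u => ?_⟩
  have h1 : ‖(hmem u).toLp‖ ≤ c * ‖(hbd u).toLp‖ := by
    refine Lp.norm_le_mul_norm_of_ae_le_mul ?_
    filter_upwards [(hmem u).coeFn_toLp, (hbd u).coeFn_toLp] with t h1 h2
    rw [h1, h2, Real.norm_of_nonneg (by positivity)]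
    exact hA3 _
  have h2 : ‖(hbd u).toLp‖ ≤ ‖hone.toLp‖ + ‖u‖ := by
    have h3 : (hbd u).toLp = hone.toLp + (Lp.memLp u).norm.toLp := rfl
    have h4 : ‖(Lp.memLp u).norm.toLp‖ = ‖u‖ := by
      rw [Lp.norm_toLp, eLpNorm_norm, Lp.norm_def]
    rw [h3, ← h4]
    exact norm_add_le _ _
  refine h1.trans ?_
  rw [mul_assoc]
  gcongr
  nlinarith [norm_nonneg hone.toLp, norm_nonneg u]

theorem lpDualPairing_superposition_monotone {A : V → StrongDual ℝ V} (hA2 : IsMonotoneOp A)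
    {S : L2Time T V → L2Time T (StrongDual ℝ V)}
    (hS : ∀ u, ∀ᵐ t ∂(volume : Measure ℝ).restrict (Icc 0 T), S u t = A (u t))
    (u w : L2Time T V) : lpDualPairing _ V (S u - S w) (u - w) ≤ 0 := by
  rw [lpDualPairing_apply]
  refine integral_nonpos_of_ae ?_
  filter_upwards [hS u, hS w, Lp.coeFn_sub (S u) (S w), Lp.coeFn_sub u w] with t h1 h2 h3 h4
  rw [h3, h4, Pi.sub_apply, Pi.sub_apply, h1, h2]
  exact hA2 _ _

theorem lpDualPairing_superposition_coercive {A : V → StrongDual ℝ V} {α : ℝ}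
    (hA1 : ∀ u : V, 2 * A u u + α * ‖u‖ ^ 2 ≤ 0)
    {S : L2Time T V → L2Time T (StrongDual ℝ V)}
    (hS : ∀ u, ∀ᵐ t ∂(volume : Measure ℝ).restrict (Icc 0 T), S u t = A (u t))
    (u : L2Time T V) : 2 * lpDualPairing _ V (S u) u + α * ‖u‖ ^ 2 ≤ 0 := by
  rw [lpDualPairing_apply, norm_Lp_sq_eq, ← integral_const_mul, ← integral_const_mul,
    ← integral_add ((integrable_dual_apply (Lp.memLp _) (Lp.memLp _)).const_mul 2)
      ((Lp.memLp u).norm.integrable_sq.const_mul α)]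
  refine integral_nonpos_of_ae ?_
  filter_upwards [hS u] with t h1
  rw [h1]
  exact hA1 _

theorem tendsto_lpDualPairing_superposition {A : V → StrongDual ℝ V} (hA3 : HasLinearGrowth A)
    (hA4 : IsHemicontinuous A) {S : L2Time T V → L2Time T (StrongDual ℝ V)}
    (hS : ∀ u, ∀ᵐ t ∂(volume : Measure ℝ).restrict (Icc 0 T), S u t = A (u t))
    (u z : L2Time T V) :
    Tendsto (fun n : ℕ => lpDualPairing _ V (S (u + (1 / ((n : ℝ) + 1)) • z)) z) atTop
      (𝓝 (lpDualPairing _ V (S u) z)) := by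
  obtain ⟨c, hc, hA3⟩ := hA3
  have hone : MemLp (fun _ : ℝ => (1 : ℝ)) 2 (volume.restrict (Icc 0 T)) := memLp_const 1
  simp only [lpDualPairing_apply]
  refine tendsto_integral_of_dominated_convergence
    (fun t => c * (1 + (‖u t‖ + ‖z t‖)) * ‖z t‖)
    (fun n => (integrable_dual_apply (Lp.memLp _) (Lp.memLp _)).aestronglyMeasurable) ?_ ?_ ?_
  · exact ((hone.add ((Lp.memLp u).norm.add (Lp.memLp z).norm)).const_mul c).integrable_mul
      (Lp.memLp z).norm
  · intro n
    let θ : ℝ := 1 / ((n : ℝ) + 1)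
    have hθ0 : 0 ≤ θ := Nat.one_div_pos_of_nat.le
    have hθ1 : θ ≤ 1 := by
      simp only [θ]
      rw [div_le_one (by positivity)]
      linarith [Nat.cast_nonneg (α := ℝ) n]
    filter_upwards [hS (u + θ • z), Lp.coeFn_add u (θ • z), Lp.coeFn_smul θ z] with t h1 h2 h3
    rw [h1, h2, Pi.add_apply, h3, Pi.smul_apply]
    refine ((A (u t + θ • z t)).le_opNorm _).trans ?_
    gcongr
    refine (hA3 _).trans ?_
    gcongr
    refine (norm_add_le _ _).trans ?_
    gcongr
    rw [norm_smul, Real.norm_of_nonneg hθ0]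
    exact mul_le_of_le_one_left (norm_nonneg _) hθ1
  · have hall : ∀ᵐ t ∂(volume : Measure ℝ).restrict (Icc 0 T), ∀ n : ℕ,
        S (u + (1 / ((n : ℝ) + 1)) • z) t = A (u t + (1 / ((n : ℝ) + 1)) • z t) := by
      refine ae_all_iff.2 fun n => ?_
      filter_upwards [hS (u + (1 / ((n : ℝ) + 1)) • z), Lp.coeFn_add u ((1 / ((n : ℝ) + 1)) • z),
        Lp.coeFn_smul (1 / ((n : ℝ) + 1)) z] with t h1 h2 h3
      rw [h1, h2, Pi.add_apply, h3, Pi.smul_apply]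
    filter_upwards [hS u, hall] with t h1 h2
    simp only [h1, h2]
    have h3 := ((hA4 (u t) (z t) (z t)).tendsto 0).comp
      (tendsto_one_div_add_atTop_nhds_zero_nat (𝕜 := ℝ))
    simpa [Function.comp_def] using h3

end Superposition

/-- A minimax theorem: a matrix which is nonnegative as a quadratic form on the simplex maps some
point of the simplex to the nonnegative orthant. -/
theorem exists_mem_stdSimplex_sum_nonneg {n : Type*} [Fintype n] [Nonempty n]
    (C : n → n → ℝ) (hC : ∀ p ∈ stdSimplex ℝ n, 0 ≤ ∑ i, p i * ∑ j, p j * C i j) :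
    ∃ p ∈ stdSimplex ℝ n, ∀ i, 0 ≤ ∑ j, p j * C i j := by
  classical
  let M : (n → ℝ) →ₗ[ℝ] (n → ℝ) := Matrix.mulVecLin (Matrix.of C)
  have hM : ∀ p i, M p i = ∑ j, p j * C i j := fun p i => by
    simp [M, Matrix.mulVec, dotProduct, mul_comm]
  by_contra! hcon
  have hdisj : Disjoint (M '' stdSimplex ℝ n) (Ici (0 : n → ℝ)) := by
    rw [disjoint_left]
    rintro _ ⟨p, hp, rfl⟩ hp2
    obtain ⟨i, hi⟩ := hcon p hp
    rw [← hM] at hi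
    exact absurd (hp2 i) (not_le.2 hi)
  obtain ⟨f, a, b, h1, h2, h3⟩ := geometric_hahn_banach_compact_closed
    ((convex_stdSimplex ℝ n).linear_image M)
    ((isCompact_stdSimplex ℝ n).image M.continuous_of_finiteDimensional)
    (convex_Ici 0) isClosed_Ici hdisj
  have hb : b < 0 := by simpa using h3 0 (mem_Ici.2 le_rfl)
  let q : n → ℝ := fun i => f (Pi.single i 1)
  have hf : ∀ x : n → ℝ, f x = ∑ i, q i * x i := by
    intro x
    conv_lhs => rw [pi_eq_sum_univ' x]
    rw [map_sum]
    refine Finset.sum_congr rfl fun i _ => ?_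
    rw [map_smul, smul_eq_mul, mul_comm]
  have hq : ∀ i, 0 ≤ q i := by
    intro i
    by_contra! hneg
    have h4 := h3 ((b / q i) • Pi.single i 1) (mem_Ici.2 (smul_nonneg
      (div_nonneg_of_nonpos hb.le hneg.le) (Pi.single_nonneg.2 zero_le_one)))
    rw [map_smul, smul_eq_mul] at h4
    change b < b / q i * q i at h4
    rw [div_mul_cancel₀ _ hneg.ne] at h4
    exact lt_irrefl _ h4
  have hqs : 0 < ∑ i, q i := by
    refine lt_of_le_of_ne (Finset.sum_nonneg fun i _ => hq i) fun h0 => ?_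
    have h4 : ∀ i, q i = 0 := fun i =>
      (Finset.sum_eq_zero_iff_of_nonneg fun i _ => hq i).1 h0.symm i (Finset.mem_univ i)
    obtain ⟨i⟩ := ‹Nonempty n›
    have h5 := h1 _ ⟨Pi.single i 1, single_mem_stdSimplex ℝ i, rfl⟩
    rw [hf] at h5
    simp only [h4, zero_mul, Finset.sum_const_zero] at h5
    linarith
  let p : n → ℝ := fun i => q i / ∑ i, q i
  have hp : p ∈ stdSimplex ℝ n := by
    refine ⟨fun i => div_nonneg (hq i) hqs.le, ?_⟩
    simp only [p]
    rw [← Finset.sum_div, div_self hqs.ne']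
  have h4 := h1 _ ⟨p, hp, rfl⟩
  have h5 : f (M p) = (∑ i, q i) * ∑ i, p i * ∑ j, p j * C i j := by
    rw [hf, Finset.mul_sum]
    refine Finset.sum_congr rfl fun i _ => ?_
    rw [hM, ← mul_assoc]
    simp only [p]
    rw [mul_div_cancel₀ _ hqs.ne']
  have h6 := mul_nonneg hqs.le (hC p hp)
  rw [← h5] at h6
  linarith

section Approximation

variable {V H : Type*} [NormedAddCommGroup V] [NormedSpace ℝ V]
  [NormedAddCommGroup H] [InnerProductSpace ℝ H] {T : ℝ}

/-- Weak compactness of balls of `L²([0,T]; V)`, in the form of a finite intersection property for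
half spaces defined by elements of `L²([0,T]; V*)`. -/
theorem exists_forall_lpDualPairing_le [TopologicalSpace.SeparableSpace V]
    (hV : Function.Surjective (NormedSpace.inclusionInDoubleDual ℝ V)) {κ : Type*}
    (g : κ → L2Time T (StrongDual ℝ V)) (k : κ → ℝ) {R : ℝ}
    (hfin : ∀ F : Finset κ, ∃ u : L2Time T V, ‖u‖ ≤ R ∧ ∀ i ∈ F, lpDualPairing _ V (g i) u ≤ k i) :
    ∃ u : L2Time T V, ‖u‖ ≤ R ∧ ∀ i, lpDualPairing _ V (g i) u ≤ k i := by
  let J : V ≃ₗᵢ[ℝ] StrongDual ℝ (StrongDual ℝ V) :=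
    LinearIsometryEquiv.ofSurjective (NormedSpace.inclusionInDoubleDualLi ℝ) hV
  have hJ : ∀ v f, J v f = f v := fun v f => rfl
  have : TopologicalSpace.SeparableSpace (StrongDual ℝ (StrongDual ℝ V)) :=
    J.surjective.denseRange.separableSpace J.continuous
  let Y := L2Time T (StrongDual ℝ V)
  let K : Set (WeakDual ℝ Y) := WeakDual.toStrongDual ⁻¹' Metric.closedBall 0 R
  have hK : IsCompact K := WeakDual.isCompact_closedBall 0 R
  let s : κ → Set (WeakDual ℝ Y) := fun i => {Φ | Φ (g i) ≤ k i}
  have hs : ∀ i, IsClosed (s i) := fun i =>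
    isClosed_le (WeakDual.eval_continuous (g i)) continuous_const
  obtain ⟨Φ, hΦK, hΦ⟩ := hK.inter_iInter_nonempty s hs fun F => by
    obtain ⟨u, hu, huF⟩ := hfin F
    let Ψ : StrongDual ℝ Y := (lpDualPairing _ V).flip u
    refine ⟨StrongDual.toWeakDual Ψ, ?_, ?_⟩
    · refine (mem_closedBall_zero_iff (E := StrongDual ℝ Y)).2 (le_trans ?_ hu)
      refine ContinuousLinearMap.opNorm_le_bound _ (norm_nonneg _) fun x => ?_
      rw [mul_comm]
      exact norm_lpDualPairing_le x u
    · simp only [mem_iInter]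
      exact fun i hi => huF i hi
  obtain ⟨G, hG, hGΦ⟩ := exists_lpDualPairing_eq (WeakDual.toStrongDual Φ)
  let j : StrongDual ℝ (StrongDual ℝ V) →L[ℝ] V := (J.symm.toContinuousLinearEquiv : _ →L[ℝ] _)
  have hj : ∀ z, j z = J.symm z := fun _ => rfl
  refine ⟨j.compLp G, ?_, fun i => ?_⟩
  · refine le_trans ?_ (hG.trans ((mem_closedBall_zero_iff (E := StrongDual ℝ Y)).1 hΦK))
    refine Lp.norm_le_norm_of_ae_le ?_
    filter_upwards [j.coeFn_compLp G] with t ht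
    rw [ht, hj, LinearIsometryEquiv.norm_map]
  · have h1 : lpDualPairing _ V (g i) (j.compLp G) = Φ (g i) := by
      change _ = WeakDual.toStrongDual Φ (g i)
      rw [← hGΦ, lpDualPairing_apply, lpDualPairing_apply]
      refine integral_congr_ae ?_
      filter_upwards [j.coeFn_compLp G] with t ht
      rw [ht, hj, ← hJ, LinearIsometryEquiv.apply_symm_apply]
    rw [h1]
    exact mem_iInter.1 hΦ i

/-- The Minty functional of a test triple `w`, evaluated at `u`. -/
def mintyFunctional (hT : 0 < T) (S : L2Time T V → L2Time T (StrongDual ℝ V))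
    (B : L2Time T (StrongDual ℝ V)) (u₀ : H)
    (w : L2Time T V × L2Time T (StrongDual ℝ V) × C(Icc (0 : ℝ) T, H)) (u : L2Time T V) : ℝ :=
  lpDualPairing _ V (w.2.1 - S w.1 - B) (w.1 - u) +
    1 / 2 * ‖w.2.2 ⟨0, left_mem_Icc.2 hT.le⟩ - u₀‖ ^ 2

variable [CompleteSpace H] {ι : V →L[ℝ] H}

theorem sum_mintyFunctional_nonneg (hι : DenseRange ι) (hT : 0 < T)
    {S : L2Time T V → L2Time T (StrongDual ℝ V)}
    (hS : ∀ u w, lpDualPairing _ V (S u - S w) (u - w) ≤ 0)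
    (B : L2Time T (StrongDual ℝ V)) (u₀ : H) {n : Type*} [Fintype n]
    (w : n → L2Time T V × L2Time T (StrongDual ℝ V) × C(Icc (0 : ℝ) T, H))
    (hw : ∀ i, w i ∈ energySpace ι T) {p : n → ℝ} (hp : p ∈ stdSimplex ℝ n) :
    0 ≤ ∑ i, p i * mintyFunctional hT S B u₀ (w i) (∑ j, p j • (w j).1) := by
  let z := ∑ j, p j • w j
  have hz : z ∈ energySpace ι T := Submodule.sum_mem _ fun j _ => Submodule.smul_mem _ _ (hw j)
  have hz1 : z.1 = ∑ j, p j • (w j).1 := by simp [z, Prod.fst_sum]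
  have hz2 : ∀ t, z.2.2 t = ∑ j, p j • (w j).2.2 t := fun t => by
    simp [z, Prod.snd_sum, ContinuousMap.sum_apply]
  rw [← hz1]
  let t₀ : Icc (0 : ℝ) T := ⟨0, left_mem_Icc.2 hT.le⟩
  let a : n → H := fun i => (w i).2.2 t₀ - u₀
  let b : H := z.2.2 t₀ - u₀
  let L := z.2.1 - S z.1 - B
  have hb : ∑ i, p i • a i = b := by
    simp only [a, b, smul_sub, Finset.sum_sub_distrib, ← Finset.sum_smul, hp.2, one_smul, hz2]
  have hi : ∀ i, lpDualPairing _ V L ((w i).1 - z.1) + (⟪a i, b⟫_ℝ - 1 / 2 * ‖b‖ ^ 2) ≤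
      mintyFunctional hT S B u₀ (w i) z.1 := by
    intro i
    have h1 := lpDualPairing_self hι hT (sub_mem (hw i) hz)
    have h2 := hS (w i).1 z.1
    have h3 : ((w i - z).2.2 t₀) = a i - b := by
      simp [a, b]
    change 2 * _ = _ - ‖(w i - z).2.2 t₀‖ ^ 2 at h1
    rw [h3, norm_sub_sq_real] at h1
    have h4 := sq_nonneg ‖(w i - z).2.2 ⟨T, right_mem_Icc.2 hT.le⟩‖
    simp only [Prod.fst_sub, Prod.snd_sub] at h1 h4
    have h5 : (w i).2.1 - S (w i).1 - B = L + ((w i).2.1 - z.2.1) - (S (w i).1 - S z.1) := by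
      simp only [L]
      abel
    simp only [mintyFunctional]
    have h6 : ∀ (d s : L2Time T (StrongDual ℝ V)) (v : L2Time T V),
        lpDualPairing _ V (L + d - s) v =
          lpDualPairing _ V L v + lpDualPairing _ V d v - lpDualPairing _ V s v := by
      intro d s v
      rw [map_sub, map_add, sub_apply, add_apply]
    rw [h5, h6]
    change _ ≤ _ + 1 / 2 * ‖a i‖ ^ 2
    linarith
  calc (0 : ℝ) ≤ 1 / 2 * ‖b‖ ^ 2 := by positivity
    _ = ∑ i, p i * (lpDualPairing _ V L ((w i).1 - z.1) + (⟪a i, b⟫_ℝ - 1 / 2 * ‖b‖ ^ 2)) := by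
        have e1 : ∑ i, p i * lpDualPairing _ V L ((w i).1 - z.1) = 0 := by
          have : ∑ i, p i • ((w i).1 - z.1) = 0 := by
            simp only [smul_sub, Finset.sum_sub_distrib, ← Finset.sum_smul, hp.2, one_smul, ← hz1,
              sub_self]
          have h6 := congrArg (lpDualPairing _ V L) this
          rw [map_sum, map_zero] at h6
          simpa only [map_smul, smul_eq_mul] using h6
        have e2 : ∑ i, p i * ⟪a i, b⟫_ℝ = ‖b‖ ^ 2 := by
          rw [← real_inner_self_eq_norm_sq]
          nth_rewrite 2 [← hb]
          rw [sum_inner]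
          simp only [real_inner_smul_left]
        simp only [mul_add, mul_sub, Finset.sum_add_distrib, Finset.sum_sub_distrib, e1, e2,
          ← Finset.sum_mul, hp.2]
        ring
    _ ≤ _ := Finset.sum_le_sum fun i _ => mul_le_mul_of_nonneg_left (hi i) (hp.1 i)

theorem exists_finset_mintyFunctional_nonneg (hι : DenseRange ι) (hT : 0 < T)
    {S : L2Time T V → L2Time T (StrongDual ℝ V)}
    (hS : ∀ u w, lpDualPairing _ V (S u - S w) (u - w) ≤ 0)
    (B : L2Time T (StrongDual ℝ V)) (u₀ : H) {R : ℝ} {n : Type*} [Fintype n] [Nonempty n]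
    (w : n → L2Time T V × L2Time T (StrongDual ℝ V) × C(Icc (0 : ℝ) T, H))
    (hw : ∀ i, w i ∈ energySpace ι T) (hR : ∀ i, ‖(w i).1‖ ≤ R) :
    ∃ u : L2Time T V, ‖u‖ ≤ R ∧ ∀ i, 0 ≤ mintyFunctional hT S B u₀ (w i) u := by
  have haff : ∀ p ∈ stdSimplex ℝ n, ∀ i,
      ∑ j, p j * mintyFunctional hT S B u₀ (w i) (w j).1 =
        mintyFunctional hT S B u₀ (w i) (∑ j, p j • (w j).1) := by
    intro p hp i
    simp only [mintyFunctional, map_sub _ (w i).1, map_sum, map_smul, smul_eq_mul, mul_add, mul_sub,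
      Finset.sum_add_distrib, Finset.sum_sub_distrib, ← Finset.sum_mul, hp.2, one_mul]
  obtain ⟨p, hp, hpi⟩ := exists_mem_stdSimplex_sum_nonneg
    (fun i j => mintyFunctional hT S B u₀ (w i) (w j).1) fun p hp => by
      simp only [haff p hp]
      exact sum_mintyFunctional_nonneg hι hT hS B u₀ w hw hp
  refine ⟨∑ j, p j • (w j).1, ?_, fun i => by rw [← haff p hp]; exact hpi i⟩
  refine (norm_sum_le _ _).trans ?_
  calc ∑ j, ‖p j • (w j).1‖ ≤ ∑ j, p j * R := Finset.sum_le_sum fun j _ => by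
        rw [norm_smul, Real.norm_of_nonneg (hp.1 j)]
        exact mul_le_mul_of_nonneg_left (hR j) (hp.1 j)
    _ = R := by rw [← Finset.sum_mul, hp.2, one_mul]

/-- A solution of the Minty inequality in a ball. -/
theorem exists_forall_mintyFunctional_nonneg [TopologicalSpace.SeparableSpace V]
    (hV : Function.Surjective (NormedSpace.inclusionInDoubleDual ℝ V))
    (hι : DenseRange ι) (hT : 0 < T)
    {S : L2Time T V → L2Time T (StrongDual ℝ V)}
    (hS : ∀ u w, lpDualPairing _ V (S u - S w) (u - w) ≤ 0)
    (B : L2Time T (StrongDual ℝ V)) (u₀ : H) {R : ℝ} (hR : 0 ≤ R) :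
    ∃ u : L2Time T V, ‖u‖ ≤ R ∧ ∀ w ∈ energySpace ι T, ‖w.1‖ ≤ R →
      0 ≤ mintyFunctional hT S B u₀ w u := by
  let κ := {w : L2Time T V × L2Time T (StrongDual ℝ V) × C(Icc (0 : ℝ) T, H) //
    w ∈ energySpace ι T ∧ ‖w.1‖ ≤ R}
  have hiff : ∀ (w : L2Time T V × L2Time T (StrongDual ℝ V) × C(Icc (0 : ℝ) T, H))
      (u : L2Time T V), 0 ≤ mintyFunctional hT S B u₀ w u ↔
      lpDualPairing _ V (w.2.1 - S w.1 - B) u ≤ lpDualPairing _ V (w.2.1 - S w.1 - B) w.1 +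
        1 / 2 * ‖w.2.2 ⟨0, left_mem_Icc.2 hT.le⟩ - u₀‖ ^ 2 := by
    intro w u
    rw [mintyFunctional, map_sub _ w.1]
    constructor <;> intro h <;> linarith
  obtain ⟨u, hu, hui⟩ := exists_forall_lpDualPairing_le hV
    (fun w : κ => w.1.2.1 - S w.1.1 - B)
    (fun w : κ => lpDualPairing _ V (w.1.2.1 - S w.1.1 - B) w.1.1 +
        1 / 2 * ‖w.1.2.2 ⟨0, left_mem_Icc.2 hT.le⟩ - u₀‖ ^ 2) (R := R) fun F => by
      rcases F.eq_empty_or_nonempty with rfl | hF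
      · exact ⟨0, by simpa using hR, by simp⟩
      · have : Nonempty F := hF.to_subtype
        obtain ⟨u, hu, hui⟩ := exists_finset_mintyFunctional_nonneg hι hT hS B u₀
          (fun i : F => i.1.1) (fun i => i.1.2.1) (fun i => i.1.2.2)
        exact ⟨u, hu, fun i hi => (hiff _ _).1 (hui ⟨i, hi⟩)⟩
  exact ⟨u, hu, fun w hw hwR => (hiff _ _).2 (hui ⟨w, hw, hwR⟩)⟩

end Approximation

theorem mintyFunctional_eq {V H : Type*} [NormedAddCommGroup V] [NormedSpace ℝ V]
    [NormedAddCommGroup H] {T : ℝ} (hT : 0 < T) (S : L2Time T V → L2Time T (StrongDual ℝ V))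
    (B : L2Time T (StrongDual ℝ V)) (u₀ : H)
    (w : L2Time T V × L2Time T (StrongDual ℝ V) × C(Icc (0 : ℝ) T, H)) (u : L2Time T V) :
    mintyFunctional hT S B u₀ w u = lpDualPairing _ V w.2.1 w.1 - lpDualPairing _ V w.2.1 u -
      lpDualPairing _ V (S w.1 + B) (w.1 - u) +
      1 / 2 * ‖w.2.2 ⟨0, left_mem_Icc.2 hT.le⟩ - u₀‖ ^ 2 := by
  simp only [mintyFunctional]
  rw [sub_sub, map_sub (lpDualPairing (volume.restrict (Icc 0 T)) V), sub_apply,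
    map_sub _ w.1 u]

section Identification

variable {V H : Type*} [NormedAddCommGroup V] [NormedSpace ℝ V]
  [NormedAddCommGroup H] [InnerProductSpace ℝ H] {T : ℝ}

theorem integrableOn_of_L2Time {E : Type*} [NormedAddCommGroup E] (u : L2Time T E) :
    IntegrableOn u (Icc 0 T) :=
  (Lp.memLp u).integrable (by norm_num)

/-- The weak derivative may be tested against elementary tensors. -/
theorem hasWeakTimeDeriv_of_forall_lpDualPairing {ι : V →L[ℝ] H} {u : L2Time T V}
    {u' : L2Time T (StrongDual ℝ V)}
    (h : ∀ φ : ℝ → ℝ, ContDiff ℝ ∞ φ → tsupport φ ⊆ Ioo 0 T → ∀ x : V,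
      ∫ t in Icc 0 T, deriv φ t * ⟪ι x, ι (u t)⟫_ℝ = -∫ t in Icc 0 T, φ t * u' t x) :
    HasWeakTimeDeriv T (fun t => toVDual ι (ι (u t))) u' := by
  let Jι : V →L[ℝ] StrongDual ℝ V :=
    ((ContinuousLinearMap.compL ℝ V H ℝ).flip ι).comp ((innerSL ℝ).comp ι)
  have hJ : ∀ v, toVDual ι (ι v) = Jι v := fun v => rfl
  have hu : IntegrableOn (fun t => toVDual ι (ι (u t))) (Icc 0 T) := by
    simp only [hJ]
    exact Jι.integrable_comp (integrableOn_of_L2Time u)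
  refine ⟨hu, integrableOn_of_L2Time u', fun φ hφ hc hs => ?_⟩
  have hφ1 : ContDiff ℝ 1 φ := hφ.of_le (by exact_mod_cast le_top)
  have hd : ContinuousOn (deriv φ) (Icc 0 T) := (hφ1.continuous_deriv le_rfl).continuousOn
  ext x
  rw [neg_apply, ContinuousLinearMap.integral_apply (hu.continuousOn_smul hd isCompact_Icc),
    ContinuousLinearMap.integral_apply
      ((integrableOn_of_L2Time u').continuousOn_smul hφ.continuous.continuousOn isCompact_Icc)]
  refine Eq.trans (integral_congr_ae (Eventually.of_forall fun t => ?_)) (h φ hφ hs x)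
  simp only [smul_apply, smul_eq_mul, toVDual_apply]
  rw [real_inner_comm]

theorem ae_eq_zero_of_forall_lpDualPairing {L : L2Time T (StrongDual ℝ V)}
    (h : ∀ φ : ℝ → ℝ, ContDiff ℝ ∞ φ → tsupport φ ⊆ Ioo 0 T → ∀ x : V,
      ∫ t in Icc 0 T, φ t * L t x = 0) :
    ∀ᵐ t ∂(volume : Measure ℝ).restrict (Icc 0 T), L t = 0 := by
  have hL := integrableOn_of_L2Time L
  have key := isOpen_Ioo.ae_eq_zero_of_integral_contDiff_smul_eq_zero
    (hL.mono_set Ioo_subset_Icc_self).locallyIntegrableOn fun φ hφ hc hs => ?_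
  · have h1 := (ae_restrict_iff' measurableSet_Ioo).2 key
    rwa [Measure.restrict_congr_set Ioo_ae_eq_Icc] at h1
  · have hz : ∀ t, t ∉ Icc 0 T → φ t • L t = 0 := fun t ht => by
      rw [image_eq_zero_of_notMem_tsupport fun h => ht (Ioo_subset_Icc_self (hs h)), zero_smul]
    rw [← setIntegral_eq_integral_of_forall_compl_eq_zero hz]
    ext x
    rw [ContinuousLinearMap.integral_apply
      (hL.continuousOn_smul hφ.continuous.continuousOn isCompact_Icc), zero_apply]
    exact h φ hφ hs x

theorem lpDualPairing_smul_const {φ : ℝ → ℝ} (hφ : Continuous φ) (x : V)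
    (g : L2Time T (StrongDual ℝ V)) :
    lpDualPairing _ V g (memLp_continuous_smul hφ x T).toLp = ∫ t in Icc 0 T, φ t * g t x := by
  rw [lpDualPairing_apply]
  refine integral_congr_ae ?_
  filter_upwards [(memLp_continuous_smul hφ x T).coeFn_toLp] with t ht
  rw [ht, map_smul, smul_eq_mul]

theorem lpDualPairing_toVDual {ι : V →L[ℝ] H} {φ : ℝ → ℝ} (hφ : Continuous φ) (x : V)
    (u : L2Time T V) :
    lpDualPairing _ V (memLp_continuous_smul hφ (toVDual ι (ι x)) T).toLp u =
      ∫ t in Icc 0 T, φ t * ⟪ι x, ι (u t)⟫_ℝ := by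
  rw [lpDualPairing_apply]
  refine integral_congr_ae ?_
  filter_upwards [(memLp_continuous_smul hφ (toVDual ι (ι x)) T).coeFn_toLp] with t ht
  rw [ht, smul_apply, toVDual_apply, smul_eq_mul]

variable {ι : V →L[ℝ] H}

theorem bound_superposition {S : L2Time T V → L2Time T (StrongDual ℝ V)} {C : ℝ} (hC : 0 ≤ C)
    (hSC : ∀ u, ‖S u‖ ≤ C * (1 + ‖u‖)) (B : L2Time T (StrongDual ℝ V)) {R : ℝ} {w u : L2Time T V}
    (hw : ‖w‖ ≤ R) (hu : ‖u‖ ≤ R) :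
    -lpDualPairing _ V (S w + B) (w - u) ≤ (C * (1 + R) + ‖B‖) * (R + R) := by
  have h1 := norm_lpDualPairing_le (S w + B) (w - u)
  have h2 : ‖S w + B‖ ≤ C * (1 + R) + ‖B‖ :=
    (norm_add_le _ _).trans (add_le_add_left ((hSC w).trans (by gcongr)) _)
  have h3 : ‖w - u‖ ≤ R + R := (norm_sub_le _ _).trans (add_le_add hw hu)
  have h4 : ‖S w + B‖ * ‖w - u‖ ≤ (C * (1 + R) + ‖B‖) * (R + R) := by
    have := (norm_nonneg _).trans h2
    gcongr
  linarith [neg_abs_le (lpDualPairing (volume.restrict (Icc 0 T)) V (S w + B) (w - u))]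

/-- Minty's trick. -/
theorem lpDualPairing_nonneg_of_mintyFunctional_nonneg (hT : 0 < T)
    {S : L2Time T V → L2Time T (StrongDual ℝ V)}
    (hSh : ∀ u z : L2Time T V, Tendsto (fun n : ℕ => lpDualPairing _ V
      (S (u + (1 / ((n : ℝ) + 1)) • z)) z) atTop (𝓝 (lpDualPairing _ V (S u) z)))
    {B : L2Time T (StrongDual ℝ V)} {R : ℝ}
    {u : L2Time T V × L2Time T (StrongDual ℝ V) × C(Icc (0 : ℝ) T, H)}
    (hu : u ∈ energySpace ι T) (huR : ‖u.1‖ ≤ R)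
    (hmin : ∀ w ∈ energySpace ι T, ‖w.1‖ ≤ R →
      0 ≤ mintyFunctional hT S B (u.2.2 ⟨0, left_mem_Icc.2 hT.le⟩) w u.1)
    {v : L2Time T V × L2Time T (StrongDual ℝ V) × C(Icc (0 : ℝ) T, H)}
    (hv : v ∈ energySpace ι T) (hvR : ‖v.1‖ ≤ R) :
    0 ≤ lpDualPairing _ V (u.2.1 - S u.1 - B) (v.1 - u.1) := by
  let z := v - u
  have hz : z ∈ energySpace ι T := sub_mem hv hu
  let θ : ℕ → ℝ := fun n => 1 / ((n : ℝ) + 1)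
  have hθ : ∀ n, 0 < θ n := fun n => Nat.one_div_pos_of_nat
  have hθ1 : ∀ n, θ n ≤ 1 := fun n => by
    simp only [θ]
    rw [div_le_one (by positivity)]
    linarith [Nat.cast_nonneg (α := ℝ) n]
  have hθ0 : Tendsto θ atTop (𝓝 0) := tendsto_one_div_add_atTop_nhds_zero_nat
  let M := ‖z.2.2 ⟨0, left_mem_Icc.2 hT.le⟩‖ ^ 2
  have hn : ∀ n, 0 ≤ lpDualPairing _ V (u.2.1 - B) z.1 -
      lpDualPairing _ V (S (u.1 + θ n • z.1)) z.1 +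
      θ n * (lpDualPairing _ V z.2.1 z.1 + 1 / 2 * M) := by
    intro n
    have hwR : ‖(u + θ n • z).1‖ ≤ R := by
      have h1 : (u + θ n • z).1 = (1 - θ n) • u.1 + θ n • v.1 := by
        simp only [z, Prod.fst_add, Prod.smul_fst, Prod.fst_sub, smul_sub, sub_smul, one_smul]
        abel
      rw [h1]
      refine (norm_add_le _ _).trans ?_
      rw [norm_smul, norm_smul, Real.norm_of_nonneg (hθ n).le,
        Real.norm_of_nonneg (sub_nonneg.2 (hθ1 n))]
      nlinarith [hθ n, hθ1 n]
    have h1 := hmin (u + θ n • z) (add_mem hu (Submodule.smul_mem _ _ hz)) hwR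
    simp only [mintyFunctional, Prod.fst_add, Prod.snd_add, Prod.smul_fst, Prod.smul_snd,
      add_sub_cancel_left, ContinuousMap.add_apply, ContinuousMap.smul_apply, norm_smul,
      mul_pow, map_smul, smul_eq_mul] at h1
    have h2 : u.2.1 + θ n • z.2.1 - S (u.1 + θ n • z.1) - B =
        (u.2.1 - B) - S (u.1 + θ n • z.1) + θ n • z.2.1 := by abel
    rw [h2, map_add, map_sub, map_smul, add_apply, sub_apply, smul_apply, smul_eq_mul,
      Real.norm_of_nonneg (hθ n).le] at h1
    refine nonneg_of_mul_nonneg_right (a := θ n) ?_ (hθ n)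
    refine h1.trans (le_of_eq ?_)
    simp only [M]
    ring
  have hlim := ((tendsto_const_nhds (x := lpDualPairing _ V (u.2.1 - B) z.1)).sub
    (hSh u.1 z.1)).add (hθ0.mul_const (lpDualPairing _ V z.2.1 z.1 + 1 / 2 * M))
  have h3 := ge_of_tendsto' hlim hn
  rw [zero_mul, add_zero] at h3
  have h4 : u.2.1 - S u.1 - B = u.2.1 - B - S u.1 := by abel
  rw [h4, map_sub (lpDualPairing (volume.restrict (Icc 0 T)) V), sub_apply]
  exact h3

variable [CompleteSpace H]

/-- A solution of the Minty inequality has a weak derivative in `L²([0,T]; V*)`. -/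
theorem exists_hasWeakTimeDeriv_of_mintyFunctional_nonneg [CompleteSpace V]
    [TopologicalSpace.SeparableSpace (StrongDual ℝ V)] (hι : DenseRange ι) (hT : 0 < T)
    {S : L2Time T V → L2Time T (StrongDual ℝ V)} {C : ℝ} (hC : 0 ≤ C)
    (hSC : ∀ u, ‖S u‖ ≤ C * (1 + ‖u‖)) {B : L2Time T (StrongDual ℝ V)} {u₀ : H} {R : ℝ}
    (hR : 0 < R) {u : L2Time T V} (hu : ‖u‖ ≤ R)
    (hmin : ∀ w ∈ energySpace ι T, ‖w.1‖ ≤ R → 0 ≤ mintyFunctional hT S B u₀ w u) :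
    ∃ u' : L2Time T (StrongDual ℝ V), HasWeakTimeDeriv T (fun t => toVDual ι (ι (u t))) u' := by
  let Z := L2Time T V × L2Time T (StrongDual ℝ V) × C(Icc (0 : ℝ) T, H)
  let D : Submodule ℝ Z :=
    { carrier := {w | w ∈ energySpace ι T ∧ w.2.2 ⟨0, left_mem_Icc.2 hT.le⟩ = 0 ∧
        w.2.2 ⟨T, right_mem_Icc.2 hT.le⟩ = 0}
      zero_mem' := ⟨zero_mem _, rfl, rfl⟩
      add_mem' := by
        rintro w z ⟨h1, h2, h3⟩ ⟨k1, k2, k3⟩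
        refine ⟨add_mem h1 k1, ?_, ?_⟩
        · change w.2.2 _ + z.2.2 _ = 0
          rw [h2, k2, add_zero]
        · change w.2.2 _ + z.2.2 _ = 0
          rw [h3, k3, add_zero]
      smul_mem' := by
        rintro c w ⟨h1, h2, h3⟩
        refine ⟨Submodule.smul_mem _ c h1, ?_, ?_⟩
        · change c • w.2.2 _ = 0
          rw [h2, smul_zero]
        · change c • w.2.2 _ = 0
          rw [h3, smul_zero] }
  let K₀ : ℝ := (C * (1 + R) + ‖B‖) * (R + R) + 1 / 2 * ‖u₀‖ ^ 2
  have hK₀ : 0 ≤ K₀ := by positivity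
  have hball : ∀ w ∈ D, ‖w.1‖ ≤ R → lpDualPairing _ V w.2.1 u ≤ K₀ := by
    rintro w ⟨h1, h2, h3⟩ hw
    have h4 := hmin w h1 hw
    have h5 := lpDualPairing_self hι hT h1
    rw [h2, h3] at h5
    rw [mintyFunctional_eq, h2, zero_sub, norm_neg] at h4
    have h6 := bound_superposition hC hSC B hw hu
    simp only [K₀]
    linarith
  have hbound : ∀ w ∈ D, lpDualPairing _ V w.2.1 u ≤ K₀ / R * ‖w.1‖ := by
    intro w hw
    refine le_of_forall_pos_le_add fun ε hε => ?_
    let δ := ε * R / (K₀ + 1)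
    have hδ : 0 < δ := by positivity
    have hs : 0 < ‖w.1‖ + δ := by positivity
    have h1 := hball ((R / (‖w.1‖ + δ)) • w) (D.smul_mem _ hw) (by
      rw [Prod.smul_fst, norm_smul, Real.norm_of_nonneg (by positivity), div_mul_eq_mul_div,
        div_le_iff₀ hs]
      gcongr
      linarith)
    rw [Prod.smul_snd, Prod.smul_fst, map_smul, smul_apply, smul_eq_mul, div_mul_eq_mul_div,
      div_le_iff₀ hs, ← le_div_iff₀' hR] at h1
    refine h1.trans ?_
    have h2 : K₀ * δ / R ≤ ε := by
      simp only [δ]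
      rw [div_le_iff₀ hR, ← mul_div_assoc, div_le_iff₀ (by positivity)]
      nlinarith [mul_pos hε hR]
    calc K₀ * (‖w.1‖ + δ) / R = K₀ / R * ‖w.1‖ + K₀ * δ / R := by ring
      _ ≤ _ := by linarith
  let ℓ : Z →ₗ[ℝ] ℝ :=
    { toFun := fun w => -lpDualPairing _ V w.2.1 u
      map_add' := fun w z => by
        rw [Prod.snd_add, Prod.fst_add, map_add, add_apply]; ring
      map_smul' := fun c w => by
        rw [Prod.smul_snd, Prod.smul_fst, map_smul, smul_apply]; simp }
  let K := K₀ / R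
  have hK : 0 ≤ K := by positivity
  obtain ⟨F, hF1, hF2⟩ := exists_extension_of_le_sublinear
    (⟨D, ℓ.comp D.subtype⟩ : Z →ₗ.[ℝ] ℝ) (fun w => K * ‖w.1‖)
    (fun c hc w => by
      rw [Prod.smul_fst, norm_smul, Real.norm_of_nonneg hc.le]; ring)
    (fun w z => by
      rw [Prod.fst_add, ← mul_add]
      gcongr
      exact norm_add_le _ _)
    (fun w => by
      change ℓ w.1 ≤ _
      have h1 := hbound (-w.1) (D.neg_mem w.2)
      rw [Prod.snd_neg, Prod.fst_neg, map_neg, neg_apply, Prod.fst_neg, norm_neg] at h1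
      exact h1)
  have hF1 : ∀ w ∈ D, F w = -lpDualPairing _ V w.2.1 u := fun w hw => hF1 ⟨w, hw⟩
  let Λ : StrongDual ℝ (L2Time T V) :=
    (F.comp (LinearMap.inl ℝ (L2Time T V) (L2Time T (StrongDual ℝ V) × C(Icc (0 : ℝ) T, H)))
      ).mkContinuous K fun ψ => by
      rw [Real.norm_eq_abs, abs_le]
      have h1 := hF2 (ψ, 0)
      have h2 := hF2 (-(ψ, 0))
      rw [map_neg, Prod.fst_neg, norm_neg] at h2
      exact ⟨neg_le.1 h2, h1⟩
  have hΛ : ∀ w ∈ D, Λ w.1 = -lpDualPairing _ V w.2.1 u := by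
    intro w hw
    rw [← hF1 w hw]
    have h0 : ∀ z : L2Time T (StrongDual ℝ V) × C(Icc (0 : ℝ) T, H), F (0, z) = 0 := by
      intro z
      have h1 := hF2 (0, z)
      have h2 := hF2 (-(0, z))
      rw [map_neg, Prod.fst_neg, norm_neg] at h2
      simp only [norm_zero, mul_zero] at h1 h2
      linarith
    have h3 : w = (w.1, 0) + (0, w.2) := by rw [Prod.mk_add_mk, add_zero, zero_add]
    conv_rhs => rw [h3, map_add, h0, add_zero]
    rfl
  obtain ⟨u', -, hu'⟩ := exists_lpDualPairing_eq Λ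
  refine ⟨u', hasWeakTimeDeriv_of_forall_lpDualPairing fun φ hφ hs x => ?_⟩
  have hφ1 : ContDiff ℝ 1 φ := hφ.of_le (by exact_mod_cast le_top)
  have hφ' : Continuous (deriv φ) := hφ1.continuous_deriv le_rfl
  have hφ0 : φ 0 = 0 := image_eq_zero_of_notMem_tsupport fun h => lt_irrefl _ (hs h).1
  have hφT : φ T = 0 := image_eq_zero_of_notMem_tsupport fun h => lt_irrefl _ (hs h).2
  have h1 := hΛ _ ⟨smul_const_mem_energySpace ι hT hφ hφ' x, by simp [hφ0], by simp [hφT]⟩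
  rw [← hu'] at h1
  have h2 := (lpDualPairing_smul_const hφ.continuous x u').symm.trans
    (h1.trans (congrArg Neg.neg (lpDualPairing_toVDual hφ' x u)))
  rw [h2, neg_neg]

/-- A solution of the Minty inequality attains the initial value. -/
theorem initial_value_of_mintyFunctional_nonneg (hι : DenseRange ι) (hT : 0 < T)
    {S : L2Time T V → L2Time T (StrongDual ℝ V)} {C : ℝ} (hC : 0 ≤ C)
    (hSC : ∀ u, ‖S u‖ ≤ C * (1 + ‖u‖)) {B : L2Time T (StrongDual ℝ V)} {u₀ : H} {R : ℝ}
    (hR : 0 < R) {u : L2Time T V × L2Time T (StrongDual ℝ V) × C(Icc (0 : ℝ) T, H)}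
    (hu : u ∈ energySpace ι T) (huR : ‖u.1‖ ≤ R)
    (hmin : ∀ w ∈ energySpace ι T, ‖w.1‖ ≤ R → 0 ≤ mintyFunctional hT S B u₀ w u.1) :
    u.2.2 ⟨0, left_mem_Icc.2 hT.le⟩ = u₀ := by
  let d := u.2.2 ⟨0, left_mem_Icc.2 hT.le⟩ - u₀
  let K := ‖u.2.1‖ * R + (C * (1 + R) + ‖B‖) * (R + R) + 1 / 2 * ‖u₀‖ ^ 2
  have hlow : ∀ x : V, -K ≤ ⟪ι x, d⟫_ℝ := by
    intro x
    obtain ⟨φ, hφ, hφ0, hφT, hφi⟩ := exists_profile hT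
      (show 0 < (R / (‖x‖ + 1)) ^ 2 by positivity)
    have hφ1 : ContDiff ℝ 1 φ := hφ.of_le (by exact_mod_cast le_top)
    have hφ' : Continuous (deriv φ) := hφ1.continuous_deriv le_rfl
    have hw := smul_const_mem_energySpace ι hT hφ hφ' x
    set w : L2Time T V × L2Time T (StrongDual ℝ V) × C(Icc (0 : ℝ) T, H) :=
      ((memLp_continuous_smul hφ.continuous x T).toLp,
        (memLp_continuous_smul hφ' (toVDual ι (ι x)) T).toLp,
        ⟨fun t => φ t • ι x, (hφ.continuous.comp continuous_subtype_val).smul continuous_const⟩)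
      with hwdef
    have hw0 : w.2.2 ⟨0, left_mem_Icc.2 hT.le⟩ = ι x := by simp [hwdef, hφ0]
    have hwT : w.2.2 ⟨T, right_mem_Icc.2 hT.le⟩ = 0 := by simp [hwdef, hφT]
    have hwR : ‖w.1‖ ≤ R := by
      refine (norm_smul_const_toLp_le hφ.continuous x T).trans ?_
      have h1 : √(∫ t in Icc 0 T, φ t ^ 2) ≤ R / (‖x‖ + 1) :=
        Real.sqrt_le_iff.2 ⟨by positivity, hφi⟩
      calc √(∫ t in Icc 0 T, φ t ^ 2) * ‖x‖ ≤ R / (‖x‖ + 1) * (‖x‖ + 1) := by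
            gcongr
            linarith
        _ = R := div_mul_cancel₀ _ (by positivity)
    have h1 := hmin w hw hwR
    have h2 := lpDualPairing_self hι hT hw
    have h3 := lpDualPairing_add_swap hι hT hw hu
    rw [hw0, hwT, norm_zero] at h2
    rw [hw0, hwT, inner_zero_left] at h3
    rw [mintyFunctional_eq, hw0, norm_sub_sq_real] at h1
    have h4 := bound_superposition hC hSC B hwR huR
    have h5 : lpDualPairing _ V u.2.1 w.1 ≤ ‖u.2.1‖ * R :=
      (le_abs_self _).trans ((norm_lpDualPairing_le _ _).trans (by gcongr))
    simp only [K, d, inner_sub_right]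
    linarith
  have hzero : ∀ x : V, ⟪ι x, d⟫_ℝ = 0 := by
    intro x
    by_contra hne
    have h1 := hlow ((-(K + 1) / ⟪ι x, d⟫_ℝ) • x)
    rw [map_smul, real_inner_smul_left, div_mul_cancel₀ _ hne] at h1
    linarith
  have hd : d = 0 := by
    refine ext_inner_left ℝ fun y => ?_
    rw [inner_zero_right]
    refine hι.induction_on (p := fun y => ⟪y, d⟫_ℝ = 0) y ?_ hzero
    exact isClosed_eq (by fun_prop) continuous_const
  exact sub_eq_zero.1 hd

/-- Existence for the abstract evolution equation `u' = S u + B`. -/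
theorem exists_energySpace_solution [CompleteSpace V] [TopologicalSpace.SeparableSpace V]
    [TopologicalSpace.SeparableSpace (StrongDual ℝ V)]
    (hV : Function.Surjective (NormedSpace.inclusionInDoubleDual ℝ V))
    (hι : DenseRange ι) (hT : 0 < T)
    {S : L2Time T V → L2Time T (StrongDual ℝ V)} {C : ℝ} (hC : 0 ≤ C)
    (hSC : ∀ u, ‖S u‖ ≤ C * (1 + ‖u‖))
    (hSm : ∀ u w, lpDualPairing _ V (S u - S w) (u - w) ≤ 0) {α : ℝ} (hα : 0 < α)
    (hSα : ∀ u, 2 * lpDualPairing _ V (S u) u + α * ‖u‖ ^ 2 ≤ 0)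
    (hSh : ∀ u z : L2Time T V, Tendsto (fun n : ℕ => lpDualPairing _ V
      (S (u + (1 / ((n : ℝ) + 1)) • z)) z) atTop (𝓝 (lpDualPairing _ V (S u) z)))
    (B : L2Time T (StrongDual ℝ V)) (u₀ : H) :
    ∃ u ∈ energySpace ι T, u.2.2 ⟨0, left_mem_Icc.2 hT.le⟩ = u₀ ∧
      ∀ᵐ t ∂(volume : Measure ℝ).restrict (Icc 0 T), u.2.1 t = S u.1 t + B t := by
  obtain ⟨R, hR, hRα⟩ : ∃ R : ℝ, 0 < R ∧ ‖u₀‖ ^ 2 + 2 * ‖B‖ * R < α * R ^ 2 := by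
    let m := ‖u₀‖ ^ 2 + 2 * ‖B‖ + 1
    have hm : 1 ≤ m := by
      have : 0 ≤ ‖u₀‖ ^ 2 + 2 * ‖B‖ := by positivity
      simp only [m]
      linarith
    refine ⟨1 + m / α, by positivity, ?_⟩
    have h1 : α * (1 + m / α) = α + m := by field_simp
    have h2 : 1 ≤ 1 + m / α := by
      have : 0 ≤ m / α := by positivity
      linarith
    calc ‖u₀‖ ^ 2 + 2 * ‖B‖ * (1 + m / α)
        ≤ ‖u₀‖ ^ 2 * (1 + m / α) + 2 * ‖B‖ * (1 + m / α) := by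
          gcongr
          exact le_mul_of_one_le_right (by positivity) h2
      _ = (‖u₀‖ ^ 2 + 2 * ‖B‖) * (1 + m / α) := by ring
      _ < (α + m) * (1 + m / α) := by
          refine mul_lt_mul_of_pos_right ?_ (lt_of_lt_of_le one_pos h2)
          change _ < α + (‖u₀‖ ^ 2 + 2 * ‖B‖ + 1)
          linarith
      _ = α * (1 + m / α) ^ 2 := by rw [← h1]; ring
  obtain ⟨u, huR, hmin⟩ := exists_forall_mintyFunctional_nonneg hV hι hT hSm B u₀ hR.le
  obtain ⟨u', hu'⟩ := exists_hasWeakTimeDeriv_of_mintyFunctional_nonneg hι hT hC hSC hR huR hmin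
  obtain ⟨U, hU, -⟩ := hu'.exists_continuousVersion hι (toVDual_injective hι) hT
  have hw : (u, u', U) ∈ energySpace ι T := ⟨hu', hU⟩
  have h0 : U ⟨0, left_mem_Icc.2 hT.le⟩ = u₀ :=
    initial_value_of_mintyFunctional_nonneg (u := (u, u', U)) hι hT hC hSC hR hw huR hmin
  let L := u' - S u - B
  have hL : ∀ v ∈ energySpace ι T, ‖v.1‖ ≤ R → 0 ≤ lpDualPairing _ V L (v.1 - u) :=
    fun v hv hvR => lpDualPairing_nonneg_of_mintyFunctional_nonneg (u := (u, u', U)) hT hSh hw huR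
      (by
        change ∀ w ∈ energySpace ι T, ‖w.1‖ ≤ R → 0 ≤ mintyFunctional hT S B (U _) w u
        rw [h0]
        exact hmin) hv hvR
  have hlt : ‖u‖ < R := by
    refine lt_of_le_of_ne huR fun heq => ?_
    have h1 := hL 0 (zero_mem _) (by simpa using hR.le)
    have h2 := lpDualPairing_self hι hT hw
    change 2 * lpDualPairing _ V u' u = ‖U _‖ ^ 2 - ‖U _‖ ^ 2 at h2
    rw [h0] at h2
    have h3 := hSα u
    have h4 : lpDualPairing _ V B u ≤ ‖B‖ * R := by
      rw [← heq]
      exact (le_abs_self _).trans (norm_lpDualPairing_le _ _)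
    simp only [L, Prod.fst_zero, zero_sub, map_neg] at h1
    rw [map_sub, map_sub, sub_apply, sub_apply] at h1
    have h5 := sq_nonneg ‖U ⟨T, right_mem_Icc.2 hT.le⟩‖
    rw [heq] at h3
    linarith
  have hL0 : ∀ v ∈ energySpace ι T, 0 ≤ lpDualPairing _ V L v.1 := by
    intro v hv
    let δ := (R - ‖u‖) / (‖v.1‖ + 1)
    have hδ : 0 < δ := div_pos (sub_pos.2 hlt) (by positivity)
    have h1 := hL ((u, u', U) + δ • v) (add_mem hw (Submodule.smul_mem _ _ hv)) (by
      rw [Prod.fst_add, Prod.smul_fst]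
      refine (norm_add_le _ _).trans ?_
      rw [norm_smul, Real.norm_of_nonneg hδ.le]
      have h2 : δ * ‖v.1‖ ≤ R - ‖u‖ := by
        calc δ * ‖v.1‖ ≤ δ * (‖v.1‖ + 1) := by gcongr; linarith
          _ = R - ‖u‖ := div_mul_cancel₀ _ (by positivity)
      linarith)
    rw [Prod.fst_add, Prod.smul_fst, add_sub_cancel_left, map_smul, smul_eq_mul] at h1
    exact nonneg_of_mul_nonneg_right h1 hδ
  have hL1 : ∀ v ∈ energySpace ι T, lpDualPairing _ V L v.1 = 0 := by
    intro v hv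
    have h1 := hL0 v hv
    have h2 := hL0 (-v) (neg_mem hv)
    rw [Prod.fst_neg, map_neg] at h2
    linarith
  have hLz : ∀ᵐ t ∂(volume : Measure ℝ).restrict (Icc 0 T), L t = 0 := by
    refine ae_eq_zero_of_forall_lpDualPairing fun φ hφ _ x => ?_
    have hφ1 : ContDiff ℝ 1 φ := hφ.of_le (by exact_mod_cast le_top)
    have h1 := hL1 _ (smul_const_mem_energySpace ι hT hφ (hφ1.continuous_deriv le_rfl) x)
    exact (lpDualPairing_smul_const hφ.continuous x L).symm.trans h1
  refine ⟨(u, u', U), hw, h0, ?_⟩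
  filter_upwards [hLz, Lp.coeFn_sub (u' - S u) B, Lp.coeFn_sub u' (S u)] with t h1 h2 h3
  simp only [L] at h1
  rw [h2, Pi.sub_apply, h3, Pi.sub_apply, sub_sub, sub_eq_zero] at h1
  exact h1

end Identification

section Uniqueness

variable {V H : Type*} [NormedAddCommGroup V] [NormedSpace ℝ V]
  [NormedAddCommGroup H] [InnerProductSpace ℝ H] [CompleteSpace H] {ι : V →L[ℝ] H} {T : ℝ}

theorem weakSolution_unique (hι : DenseRange ι) (hinj : Function.Injective ι) (hT : 0 < T)
    {A : V → StrongDual ℝ V} (hA2 : IsMonotoneOp A) {B : L2Time T (StrongDual ℝ V)}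
    {u w : L2Time T V} {U W : C(Icc (0 : ℝ) T, H)} (hu : IsWeakSolution ι A B u)
    (hw : IsWeakSolution ι A B w) (hU : IsContinuousVersion ι u U)
    (hW : IsContinuousVersion ι w W)
    (h0 : U ⟨0, left_mem_Icc.2 hT.le⟩ = W ⟨0, left_mem_Icc.2 hT.le⟩) :
    u = w ∧ U = W := by
  obtain ⟨u', hu', hue⟩ := hu
  obtain ⟨w', hw', hwe⟩ := hw
  have hd : (u, u', U) - (w, w', W) ∈ energySpace ι T := sub_mem ⟨hu', hU⟩ ⟨hw', hW⟩
  have hmono : ∀ᵐ t ∂(volume : Measure ℝ).restrict (Icc 0 T), (u' - w') t ((u - w) t) ≤ 0 := by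
    filter_upwards [hue, hwe, Lp.coeFn_sub u' w', Lp.coeFn_sub u w] with t h1 h2 h3 h4
    rw [h3, h4, Pi.sub_apply, Pi.sub_apply, sub_apply, h1, h2]
    have := hA2 (u t) (w t)
    rw [sub_apply] at this
    linarith
  have hUW : U = W := by
    ext t
    have h1 := energySpace_normSq hι hT hd t
    change ‖U t - W t‖ ^ 2 - ‖U _ - W _‖ ^ 2 = 2 * ∫ r in Icc 0 (t : ℝ), (u' - w') r ((u - w) r)
      at h1
    rw [h0, sub_self, norm_zero] at h1
    have h2 : ∫ r in Icc 0 (t : ℝ), (u' - w') r ((u - w) r) ≤ 0 :=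
      integral_nonpos_of_ae
        (ae_restrict_of_ae_restrict_of_subset (Icc_subset_Icc_right t.2.2) hmono)
    have h3 : ‖U t - W t‖ ^ 2 ≤ 0 := by linarith
    have h4 : ‖U t - W t‖ = 0 := by
      have := sq_nonneg ‖U t - W t‖
      exact pow_eq_zero_iff (two_ne_zero) |>.1 (le_antisymm h3 this)
    exact sub_eq_zero.1 (norm_eq_zero.1 h4)
  refine ⟨Lp.ext ?_, hUW⟩
  filter_upwards [ae_restrict_of_ae hU, ae_restrict_of_ae hW, ae_restrict_mem measurableSet_Icc]
    with t h1 h2 ht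
  exact hinj (by rw [← h1 ht, ← h2 ht, hUW])

end Uniqueness

end

theorem mainTheorem2 {V H : Type*} [NormedAddCommGroup V] [NormedSpace ℝ V]
    [NormedAddCommGroup H] [InnerProductSpace ℝ H]
    (ι : V →L[ℝ] H) (hι : IsGelfandTriple ι)
    (T : ℝ) (hT : 0 < T) (u₀ : H) (B : L2Time T (StrongDual ℝ V))
    (A : V → StrongDual ℝ V) (hA1 : IsCoerciveOp A) (hA2 : IsMonotoneOp A)
    (hA3 : HasLinearGrowth A) (hA4 : IsHemicontinuous A) :
    ∃! p : L2Time T V × C(Icc (0 : ℝ) T, H),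
      IsWeakSolution ι A B p.1 ∧ IsContinuousVersion ι p.1 p.2 ∧
        p.2 ⟨0, left_mem_Icc.2 hT.le⟩ = u₀ := by
  have := hι.completeSpace_V
  have := hι.completeSpace_H
  have := hι.separableSpace_V
  have : TopologicalSpace.SeparableSpace (StrongDual ℝ (StrongDual ℝ V)) :=
    hι.reflexive_V.denseRange.separableSpace (NormedSpace.inclusionInDoubleDual ℝ V).continuous
  have := separableSpace_of_separableSpace_dual (StrongDual ℝ V)
  obtain ⟨S, hS, C, hC, hSC⟩ := exists_superposition hA2 hA3 hA4 T
  obtain ⟨α, hα, hA1⟩ := hA1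
  obtain ⟨⟨u, u', U⟩, hu, h0, he⟩ := exists_energySpace_solution hι.reflexive_V hι.denseRange hT
    hC hSC (lpDualPairing_superposition_monotone hA2 hS) hα
    (lpDualPairing_superposition_coercive hA1 hS)
    (tendsto_lpDualPairing_superposition hA3 hA4 hS) B u₀
  have hsol : IsWeakSolution ι A B u := by
    refine ⟨u', hu.1, ?_⟩
    filter_upwards [he, hS u] with t h1 h2 v
    change u' t = S u t + B t at h1
    rw [h1, h2, add_apply]
  refine ⟨(u, U), ⟨hsol, hu.2, h0⟩, ?_⟩
  rintro ⟨w, W⟩ ⟨hw, hW, hW0⟩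
  obtain ⟨h1, h2⟩ := weakSolution_unique hι.denseRange hι.injective hT hA2 hw hsol hW hu.2
    (hW0.trans h0.symm)
  exact Prod.ext h1 h2
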